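/- **Theorem 1 (Convergence rate of the GNTK).** Let $G=(V,E)$ be a finite undirected simple graph with $n=|V|$ nodes, let $\mathcal N(u)$ be the set of neighbours of $u$, let $h_u\in\mathbb R^d$ ($u\in V$) be node features, let $R\ge 0$ be an integer, let $\phi$ be either the ReLU $\phi(x)=\max\{0,x\}$ (with $\phi'=\mathbf 1_{(0,\infty)}$) or $\phi=\tanh$, and let $\sigma_w,\sigma_b\in\mathbb R$ be at the edge of chaos: there is $q^*>0$ with $$\sigma_w^2\,\mathbb E[\phi(\sqrt{q^*}z)^2]+\sigma_b^2=q^*,\qquad \sigma_w^2\,\mathbb E[\phi'(\sqrt{q^*}z)^2]=1,\qquad z\sim\mathcal N(0,1).$$ (For ReLU this means $\sigma_w^2=2$, $\sigma_b=0$.) For a kernel $S:V\times V\to\mathbb R$ put $$(\mathcal A S)(u,u')=\frac1{|\mathcal N(u)|+1}\,\frac1{|\mathcal N(u')|+1}\sum_{v\in\mathcal N(u)\cup\{u\}}\ \sum_{v'\in\mathcal N(u')\cup\{u'\}}S(v,v'),$$ and let $\mathcal A(G)\in\mathbb R^{n^2\times n^2}$ be the matrix of this map on vectorized kernels. For $l\ge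 0$ and $0\le r\le R$ define the Gaussian process kernels $\Sigma^{(l)}_{(r)}$ and the graph neural tangent kernels $\Theta^{(l)}_{(r)}$ by $\Sigma^{(0)}_{(0)}(u,u')=\Theta^{(0)}_{(0)}(u,u')=\langle h_u,h_{u'}\rangle$; $\Sigma^{(l)}_{(0)}=\mathcal A\,\Sigma^{(l-1)}_{(R)}$ and $\Theta^{(l)}_{(0)}=\mathcal A\,\Theta^{(l-1)}_{(R)}$ for $l\ge1$; and, for $1\le r\le R$, $$\Sigma^{(l)}_{(r)}(u,u')=\sigma_w^2\,\mathbb E[\phi(z_1)\phi(z_2)]+\sigma_b^2,\qquad \dot\Sigma^{(l)}_{(r)}(u,u')=\sigma_w^2\,\mathbb E[\phi'(z_1)\phi'(z_2)],$$ $$\Theta^{(l)}_{(r)}(u,u')=\Theta^{(l)}_{(r-1)}(u,u')\,\dot\Sigma^{(l)}_{(r)}(u,u')+\Sigma^{(l)}_{(r)}(u,u'),$$ where $(z_1,z_2)$ is a centred Gaussian vector whose covariance matrix is the restriction of $\Sigma^{(l)}_{(r-1)}$ to $(u,u')$. Suppose that the transition matrix $\mathcal A(G)$ is irreducible and aperiodic,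 and let $\vec\pi(G)\in\mathbb R^{n^2}$ be a stationary distribution of it, i.e. a probability vector with $\vec\pi(G)^T\mathcal A(G)=\vec\pi(G)^T$. Then there are constants $0<\alpha<1$ and $C>0$, a vector $\vec v\in\mathbb R^{n^2}$ and, for each $0\le r\le R$, a vector $\vec v'=\vec v'_{(r)}\in\mathbb R^{n^2}$, all independent of $l,u,u'$, such that for all $0\le r\le R$, all $l\ge0$ and all $u,u'\in V$ $$\Big|\Theta^{(l)}_{(r)}(u,u')-\vec\pi(G)^T\big(Rl\,\vec v+\vec v'_{(r)}\big)\Big|\le C\alpha^l .$$ In particular, all entries of the GNTK matrix approach the same value at an exponential rate in the depth: $$\big|\Theta^{(l)}_{(r)}(u,u')-\Theta^{(l)}_{(r)}(w,w')\big|\le 2C\alpha^l\qquad\text{for all } u,u',w,w'\in V.$$ -/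

import Mathlib

open MeasureTheory ProbabilityTheory
open scoped Matrix Kronecker

noncomputable section

namespace GNTK

/-- The ReLU activation. Its `deriv` is the indicator of `(0, ∞)` (the value at the kink is `0`). -/
def relu (x : ℝ) : ℝ := max 0 x

/-- The centred Gaussian law on `ℝ²` whose covariance matrix is the restriction of the kernel `S`
to the pair `u, u'`. -/
def pairGaussian {V : Type*} (S : V → V → ℝ) (u u' : V) : Measure (EuclideanSpace ℝ (Fin 2)) :=
  multivariateGaussian 0 !![S u u, S u u'; S u' u, S u' u']

/-- Covariance of the next layer: `σ_w² 𝔼[φ(z₁) φ(z₂)] + σ_b²`. -/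
def covStep {V : Type*} (φ : ℝ → ℝ) (σw σb : ℝ) (S : V → V → ℝ) (u u' : V) : ℝ :=
  σw ^ 2 * ∫ z, φ (z 0) * φ (z 1) ∂(pairGaussian S u u') + σb ^ 2

/-- Derivative covariance of the next layer: `σ_w² 𝔼[φ'(z₁) φ'(z₂)]`. -/
def covDotStep {V : Type*} (φ : ℝ → ℝ) (σw : ℝ) (S : V → V → ℝ) (u u' : V) : ℝ :=
  σw ^ 2 * ∫ z, deriv φ (z 0) * deriv φ (z 1) ∂(pairGaussian S u u')

section Graph

variable {V : Type*} [Fintype V] [DecidableEq V] (G : SimpleGraph V) [DecidableRel G.Adj]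

/-- Mean aggregation of a kernel over the closed neighbourhoods `N(u) ∪ {u}`, `N(u') ∪ {u'}`. -/
def aggregate (S : V → V → ℝ) (u u' : V) : ℝ :=
  1 / ((G.degree u : ℝ) + 1) * (1 / ((G.degree u' : ℝ) + 1)) *
    ∑ v ∈ insert u (G.neighborFinset u), ∑ v' ∈ insert u' (G.neighborFinset u'), S v v'

/-- Averaging over the closed neighbourhood, as a matrix on the nodes. -/
def avgMatrix : Matrix V V ℝ :=
  Matrix.of fun u v => if v = u ∨ G.Adj u v then 1 / ((G.degree u : ℝ) + 1) else 0

/-- The aggregation operator `𝒜(G)` on vectorized kernels, with rows and columns indexed by pairs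
of nodes. -/
def aggMatrix : Matrix (V × V) (V × V) ℝ := avgMatrix G ⊗ₖ avgMatrix G

/-- The Gaussian process kernel `Σ^{(l)}_{(r)}` of the infinitely wide GCN with node features `h`
and `R` layers in each propagation unit. -/
def gpk {d : ℕ} (h : V → EuclideanSpace ℝ (Fin d)) (φ : ℝ → ℝ) (σw σb : ℝ) (R : ℕ) :
    ℕ → ℕ → V → V → ℝ
  | 0, 0 => fun u u' => inner ℝ (h u) (h u')
  | l + 1, 0 => aggregate G (gpk h φ σw σb R l R)
  | l, r + 1 => covStep φ σw σb (gpk h φ σw σb R l r)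

/-- The graph neural tangent kernel `Θ^{(l)}_{(r)}`. -/
def gntk {d : ℕ} (h : V → EuclideanSpace ℝ (Fin d)) (φ : ℝ → ℝ) (σw σb : ℝ) (R : ℕ) :
    ℕ → ℕ → V → V → ℝ
  | 0, 0 => fun u u' => inner ℝ (h u) (h u')
  | l + 1, 0 => aggregate G (gntk h φ σw σb R l R)
  | l, r + 1 => fun u u' =>
      gntk h φ σw σb R l r u u' * covDotStep φ σw (gpk G h φ σw σb R l r) u u'
        + gpk G h φ σw σb R l (r + 1) u u'

/-- Aggregation of a kernel is multiplication of the vectorized kernel by `𝒜(G)`. -/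
theorem aggMatrix_mulVec (S : V → V → ℝ) (p : V × V) :
    (aggMatrix G *ᵥ fun q => S q.1 q.2) p = aggregate G S p.1 p.2 := by
  obtain ⟨u, u'⟩ := p
  have key : ∀ (w : V) (f : V → ℝ), ∑ v, avgMatrix G w v * f v =
      1 / ((G.degree w : ℝ) + 1) * ∑ v ∈ insert w (G.neighborFinset w), f v := by
    intro w f
    rw [Finset.mul_sum, ← Finset.sum_subset (Finset.subset_univ (insert w (G.neighborFinset w)))]
    · refine Finset.sum_congr rfl fun v hv => ?_
      have : v = w ∨ G.Adj w v := by simpa using hv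
      simp [avgMatrix, this]
    · intro v _ hv
      have : ¬(v = w ∨ G.Adj w v) := by simpa using hv
      simp only [avgMatrix, Matrix.of_apply, if_neg this, zero_mul]
  simp only [Matrix.mulVec, dotProduct, aggMatrix, Matrix.kroneckerMap_apply, Fintype.sum_prod_type,
    aggregate]
  simp only [mul_assoc, ← Finset.mul_sum, key]

end Graph

/-- Aperiodicity of a transition matrix: for every state, the possible return times have greatest
common divisor `1`. -/
def IsAperiodic {ι : Type*} [Fintype ι] [DecidableEq ι] (A : Matrix ι ι ℝ) : Prop :=
  ∀ i, ∀ k : ℕ, (∀ m : ℕ, 1 ≤ m → 0 < (A ^ m) i i → k ∣ m) → k = 1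

/-- `p` is a stationary probability vector of the (row-stochastic) transition matrix `A`. -/
def IsStationaryDistribution {ι : Type*} [Fintype ι] (A : Matrix ι ι ℝ) (p : ι → ℝ) : Prop :=
  (∀ i, 0 ≤ p i) ∧ ∑ i, p i = 1 ∧ p ᵥ* A = p

/-- `(σ_w, σ_b)` lies on the edge of chaos of the activation `φ`: the variance recursion has a
nondegenerate fixed point `q`, at which `σ_w² 𝔼[φ'(√q z)²] = 1`. -/
def EdgeOfChaos (φ : ℝ → ℝ) (σw σb : ℝ) : Prop :=
  ∃ q : ℝ, 0 < q ∧
    σw ^ 2 * ∫ z, φ (√q * z) ^ 2 ∂(gaussianReal 0 1) + σb ^ 2 = q ∧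
    σw ^ 2 * ∫ z, deriv φ (√q * z) ^ 2 ∂(gaussianReal 0 1) = 1

end GNTK

end

/-!
The nodes carry self-loops, so irreducibility already makes `𝒜(G)` primitive: `x ↦ 𝒜(G) x` contracts
the oscillation of `x` over a fixed number of steps, and it still does so for subharmonic sequences
`x (l + 1) ≤ 𝒜(G) x l` and under exponentially small errors.

*Covariance kernels.* Both activations make `Σ^{(l)}_{(r)}` converge exponentially to a constant.
For ReLU, `Σ` grows entrywise in `r` while its maximum does not, so `-Σ` is subharmonic. For `tanh`,
let `q` be the critical variance and `ψ(Q) = 𝔼[tanh(√Q z)²]`. As `ψ(Q) / Q` decreases in `Q`, the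
excess of `Σ` over `q` is exponentially small and the shortfall `(q - Σ)⁺` contracts on the
diagonal. Off the diagonal the shortfall does not grow where `Σ ≥ 0`, because the slope
`σ_w² 𝔼[φ'(√q z)²]` is `1`; so it is a subharmonic sequence with a loss at one state, and decays.
That `Σ` becomes nonnegative is seen by comparison with the covariance of two copies of the network
sharing only their biases, which starts at `0` and is pushed up by a fixed amount at each layer.

*Tangent kernel.* Once `Σ → c` and `Σ̇ → 1` exponentially, a propagation unit maps `Θ` to
`𝒜(G) (Θ + R c)` up to an exponentially small relative error, so `Θ - R l c` converges.
-/

namespace GNTK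

section ExpDecay

open Filter Asymptotics Topology

/-- Exponential decay of a sequence in a normed space, at an unspecified rate `γ ∈ (0, 1)`. As this
is an asymptotic notion, finitely many terms never matter. -/
def ExpDecay {E : Type*} [Norm E] (f : ℕ → E) : Prop :=
  ∃ γ ∈ Set.Ioo (0 : ℝ) 1, f =O[atTop] fun l => γ ^ l

theorem isBigO_pow_pow {γ γ' : ℝ} (h0 : 0 ≤ γ) (h : γ ≤ γ') :
    (fun l : ℕ => γ ^ l) =O[atTop] fun l => γ' ^ l :=
  IsBigO.of_norm_le fun l => by
    rw [Real.norm_of_nonneg (by positivity)]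
    gcongr

namespace ExpDecay

variable {E F : Type*} [SeminormedAddCommGroup E] [SeminormedAddCommGroup F]
  {f g : ℕ → E}

theorem of_isBigO {g : ℕ → F} (hf : ExpDecay f) (h : g =O[atTop] f) : ExpDecay g :=
  let ⟨γ, hγ, hle⟩ := hf
  ⟨γ, hγ, h.trans hle⟩

theorem of_norm_le {g : ℕ → F} (hf : ExpDecay f) (K : ℝ) (h : ∀ l, ‖g l‖ ≤ K * ‖f l‖) :
    ExpDecay g :=
  hf.of_isBigO (IsBigO.of_bound K (Eventually.of_forall h))

theorem of_le_pow {γ : ℝ} (hγ : γ ∈ Set.Ioo 0 1) (K : ℝ) (h : ∀ l, ‖f l‖ ≤ K * γ ^ l) :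
    ExpDecay f :=
  ⟨γ, hγ, IsBigO.of_bound K <| Eventually.of_forall fun l => by
    rw [Real.norm_of_nonneg (pow_nonneg hγ.1.le l)]; exact h l⟩

protected theorem norm (hf : ExpDecay f) : ExpDecay fun l => ‖f l‖ :=
  hf.of_isBigO (isBigO_refl f atTop).norm_left

theorem pow {γ : ℝ} (hγ : γ ∈ Set.Ico 0 1) : ExpDecay fun l => γ ^ l := by
  obtain ⟨γ', hγ', h1⟩ := exists_between hγ.2
  exact ⟨γ', ⟨hγ.1.trans_lt hγ', h1⟩, isBigO_pow_pow hγ.1 hγ'.le⟩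

theorem zero : ExpDecay fun _ : ℕ => (0 : E) :=
  ⟨1 / 2, by norm_num, isBigO_zero _ _⟩

theorem add (hf : ExpDecay f) (hg : ExpDecay g) : ExpDecay fun l => f l + g l := by
  obtain ⟨γ, hγ, hf⟩ := hf
  obtain ⟨γ', hγ', hg⟩ := hg
  exact ⟨max γ γ', ⟨lt_max_of_lt_left hγ.1, max_lt hγ.2 hγ'.2⟩,
    (hf.trans (isBigO_pow_pow hγ.1.le (le_max_left _ _))).add
      (hg.trans (isBigO_pow_pow hγ'.1.le (le_max_right _ _)))⟩

theorem of_norm_le_add {G : Type*} [SeminormedAddCommGroup G] {g : ℕ → F} {h : ℕ → G}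
    (hf : ExpDecay f) (hg : ExpDecay g) (hle : ∀ l, ‖h l‖ ≤ ‖f l‖ + ‖g l‖) :
    ExpDecay h :=
  (hf.norm.add hg.norm).of_norm_le 1 fun l => by
    rw [one_mul]; exact (hle l).trans (Real.le_norm_self _)

theorem sum {ι : Type*} (s : Finset ι) {f : ι → ℕ → E} (h : ∀ i ∈ s, ExpDecay (f i)) :
    ExpDecay fun l => ∑ i ∈ s, f i l := by
  classical
  induction s using Finset.induction_on with
  | empty => simpa only [Finset.sum_empty] using zero
  | insert i s hi ih =>
    simp_rw [Finset.sum_insert hi]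
    exact (h i (by simp)).add (ih fun j hj => h j (by simp [hj]))

theorem pi {ι : Type*} [Fintype ι] {f : ℕ → ι → E} (h : ∀ i, ExpDecay fun l => f l i) :
    ExpDecay f := by
  refine (sum Finset.univ fun i _ => (h i).norm).of_norm_le 1 fun l => ?_
  rw [one_mul]
  refine (pi_norm_le_iff_of_nonneg (norm_nonneg _)).2 fun i => ?_
  exact (Finset.single_le_sum (f := fun i => ‖f l i‖) (fun _ _ => norm_nonneg _)
    (Finset.mem_univ i)).trans (Real.le_norm_self _)

theorem apply {ι : Type*} [Fintype ι] {f : ℕ → ι → E} (h : ExpDecay f) (i : ι) :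
    ExpDecay fun l => f l i :=
  h.of_norm_le 1 fun l => by rw [one_mul]; exact norm_le_pi_norm (f l) i

theorem mul_isBigO_one {R : Type*} [SeminormedRing R] {f g : ℕ → R} (hf : ExpDecay f)
    (hg : g =O[atTop] fun _ => (1 : ℝ)) : ExpDecay fun l => f l * g l := by
  obtain ⟨γ, hγ, hf⟩ := hf
  exact ⟨γ, hγ, by simpa only [mul_one] using hf.mul hg⟩

theorem const_mul {f : ℕ → ℝ} (K : ℝ) (hf : ExpDecay f) : ExpDecay fun l => K * f l :=
  hf.of_norm_le ‖K‖ fun _ => (norm_mul _ _).le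

theorem natCast_mul {f : ℕ → ℝ} (hf : ExpDecay f) : ExpDecay fun l => (l : ℝ) * f l := by
  obtain ⟨γ, ⟨h0, h1⟩, hf⟩ := hf
  obtain ⟨γ', h, h1'⟩ := exists_between h1
  have hlt : (fun l : ℕ => (l : ℝ) ^ 1 * γ ^ l) =o[atTop] fun l => γ' ^ l :=
    isLittleO_pow_const_mul_const_pow_const_pow_of_norm_lt 1 (by rwa [Real.norm_of_nonneg h0.le])
  simp_rw [pow_one] at hlt
  exact ⟨γ', ⟨h0.trans h, h1'⟩, ((isBigO_refl _ _).mul hf).trans hlt.isBigO⟩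

theorem comp_add (hf : ExpDecay f) (k : ℕ) : ExpDecay fun l => f (l + k) := by
  obtain ⟨γ, hγ, hf⟩ := hf
  refine ⟨γ, hγ, (hf.comp_tendsto (tendsto_add_atTop_nat k)).trans ?_⟩
  refine IsBigO.of_bound (γ ^ k) (Eventually.of_forall fun l => le_of_eq ?_)
  simp only [Function.comp_apply, norm_pow, norm_mul, pow_add, Real.norm_of_nonneg hγ.1.le,
    mul_comm]

theorem of_comp_add {k : ℕ} (hf : ExpDecay fun l => f (l + k)) : ExpDecay f := by
  obtain ⟨γ, hγ, hf⟩ := hf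
  have hshift : (fun l : ℕ => γ ^ l) =O[atTop] fun l => γ ^ (l + k) :=
    IsBigO.of_bound (γ ^ k)⁻¹ <| Eventually.of_forall fun l => le_of_eq <| by
      have hpow := (pow_pos hγ.1 k).ne'
      rw [norm_pow, norm_pow, Real.norm_of_nonneg hγ.1.le, pow_add]
      field_simp
  refine ⟨γ, hγ, ?_⟩
  rw [← map_add_atTop_eq_nat k, isBigO_map]
  exact hf.trans hshift

theorem summable_norm (hf : ExpDecay f) : Summable fun l => ‖f l‖ := by
  obtain ⟨γ, hγ, hf⟩ := hf
  exact summable_of_isBigO_nat (summable_geometric_of_lt_one hγ.1.le hγ.2) hf.norm_left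

theorem tendsto_zero (hf : ExpDecay f) : Tendsto f atTop (𝓝 0) :=
  tendsto_zero_iff_norm_tendsto_zero.2 hf.summable_norm.tendsto_atTop_zero

theorem exists_forall_norm_le (hf : ExpDecay f) :
    ∃ γ ∈ Set.Ioo (0 : ℝ) 1, ∃ C > 0, ∀ l, ‖f l‖ ≤ C * γ ^ l := by
  obtain ⟨γ, hγ, hf⟩ := hf
  obtain ⟨C, hC, hle⟩ := bound_of_isBigO_nat_atTop hf
  refine ⟨γ, hγ, C, hC, fun l => ?_⟩
  simpa only [Real.norm_of_nonneg (pow_nonneg hγ.1.le l)] using hle (pow_pos hγ.1 l).ne'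

theorem exists_forall_mem_norm_le {ι : Type*} (s : Finset ι) {f : ι → ℕ → E}
    (hf : ∀ i ∈ s, ExpDecay (f i)) :
    ∃ γ ∈ Set.Ioo (0 : ℝ) 1, ∃ C > 0, ∀ i ∈ s, ∀ l, ‖f i l‖ ≤ C * γ ^ l := by
  obtain ⟨γ, hγ, C, hC, hle⟩ := (sum s fun i hi => (hf i hi).norm).exists_forall_norm_le
  refine ⟨γ, hγ, C, hC, fun i hi l => ?_⟩
  exact (Finset.single_le_sum (f := fun i => ‖f i l‖) (fun _ _ => norm_nonneg _) hi).trans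
    ((Real.le_norm_self _).trans (hle l))

theorem exists_limit [CompleteSpace E] (h : ExpDecay fun l => f (l + 1) - f l) :
    ∃ κ, ExpDecay fun l => f l - κ := by
  obtain ⟨γ, hγ, C, -, hle⟩ := h.exists_forall_norm_le
  have hdist : ∀ l, dist (f l) (f (l + 1)) ≤ C * γ ^ l := fun l => by
    rw [dist_comm, dist_eq_norm]; exact hle l
  obtain ⟨κ, hκ⟩ := cauchySeq_tendsto_of_complete (cauchySeq_of_le_geometric γ C hγ.2 hdist)
  refine ⟨κ, of_le_pow hγ (C / (1 - γ)) fun l => ?_⟩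
  rw [← dist_eq_norm, div_mul_eq_mul_div]
  exact dist_le_of_le_geometric_of_tendsto γ C hγ.2 hdist hκ l

end ExpDecay

theorem exists_forall_le_of_delayed_contraction {a : ℕ → ℝ} {k : ℕ} {ρ C : ℝ} (hk : 0 < k)
    (hρ : ρ ∈ Set.Ico 0 1) (h : ∀ l, a (l + k) ≤ ρ * a l + C) :
    ∃ K, ∀ l, a l ≤ K := by
  have hpos : 0 < 1 - ρ := sub_pos.2 hρ.2
  obtain ⟨M, hM⟩ : ∃ M, ∀ j < k, a j ≤ M := by
    obtain ⟨M, hM⟩ := ((Set.finite_lt_nat k).image a).bddAbove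
    exact ⟨M, fun j hj => hM ⟨j, hj, rfl⟩⟩
  refine ⟨max M (C / (1 - ρ)), fun l => ?_⟩
  induction l using Nat.strong_induction_on with
  | _ l ih =>
    rcases lt_or_ge l k with hl | hl
    · exact le_max_of_le_left (hM l hl)
    · obtain ⟨m, rfl⟩ := Nat.exists_eq_add_of_le' hl
      have hK : C ≤ max M (C / (1 - ρ)) * (1 - ρ) := (div_le_iff₀ hpos).1 (le_max_right _ _)
      have hm : ρ * a m ≤ ρ * max M (C / (1 - ρ)) :=
        mul_le_mul_of_nonneg_left (ih m (by omega)) hρ.1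
      linarith [h m]

theorem exists_rate_between {k : ℕ} {ρ β : ℝ} (hρ : ρ < 1) (hβ : β < 1) :
    ∃ γ, β < γ ∧ ρ < γ ^ k ∧ γ < 1 := by
  have hpow : ∀ᶠ γ : ℝ in 𝓝[<] 1, ρ < γ ^ k := by
    have : Tendsto (fun γ : ℝ => γ ^ k) (𝓝 1) (𝓝 1) := by
      simpa only [one_pow] using (continuous_pow k).tendsto (1 : ℝ)
    exact (this.eventually (lt_mem_nhds hρ)).filter_mono nhdsWithin_le_nhds
  have hβ' : ∀ᶠ γ : ℝ in 𝓝[<] 1, β < γ := (lt_mem_nhds hβ).filter_mono nhdsWithin_le_nhds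
  exact (hβ'.and (hpow.and self_mem_nhdsWithin)).exists

theorem ExpDecay.of_delayed_contraction {E : Type*} [SeminormedAddCommGroup E] {f : ℕ → E}
    {ε : ℕ → ℝ} {k : ℕ} {ρ : ℝ} (hk : 0 < k) (hρ : ρ ∈ Set.Ico 0 1) (hε : ExpDecay ε)
    (h : ∀ l, ‖f (l + k)‖ ≤ ρ * ‖f l‖ + ε l) : ExpDecay f := by
  obtain ⟨β, hβ, C, hC, hle⟩ := hε.exists_forall_norm_le
  obtain ⟨γ, hβγ, hργ, hγ1⟩ := exists_rate_between (k := k) hρ.2 hβ.2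
  have hγ0 : 0 < γ := hβ.1.trans hβγ
  have hcontract : ∀ l, ‖f (l + k)‖ / γ ^ (l + k) ≤
      ρ / γ ^ k * (‖f l‖ / γ ^ l) + C / γ ^ k := fun l => by
    have hε : ε l ≤ C * γ ^ l := (Real.le_norm_self _).trans <| (hle l).trans <|
      mul_le_mul_of_nonneg_left (pow_le_pow_left₀ hβ.1.le hβγ.le l) hC.le
    calc ‖f (l + k)‖ / γ ^ (l + k) ≤ (ρ * ‖f l‖ + C * γ ^ l) / γ ^ (l + k) := by
          gcongr; linarith [h l]
      _ = ρ / γ ^ k * (‖f l‖ / γ ^ l) + C / γ ^ k := by rw [pow_add]; field_simp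
  obtain ⟨K, hK⟩ := exists_forall_le_of_delayed_contraction (a := fun l => ‖f l‖ / γ ^ l) hk
    ⟨div_nonneg hρ.1 (by positivity), (div_lt_one (by positivity)).2 hργ⟩ hcontract
  exact .of_le_pow ⟨hγ0, hγ1⟩ K fun l => (div_le_iff₀ (by positivity)).1 (hK l)

end ExpDecay

section Stochastic

open Matrix

variable {ι : Type*} [Fintype ι] [DecidableEq ι] {A : Matrix ι ι ℝ}

theorem mulVec_mono_of_mem_rowStochastic (hA : A ∈ rowStochastic ℝ ι) {x y : ι → ℝ}
    (h : ∀ i, x i ≤ y i) (i : ι) : (A *ᵥ x) i ≤ (A *ᵥ y) i :=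
  Finset.sum_le_sum fun j _ => mul_le_mul_of_nonneg_left (h j) (hA.1 i j)

theorem mulVec_const_of_mem_rowStochastic (hA : A ∈ rowStochastic ℝ ι) (c : ℝ) (i : ι) :
    (A *ᵥ fun _ => c) i = c := by
  simp only [mulVec, dotProduct, ← Finset.sum_mul, sum_row_of_mem_rowStochastic hA, one_mul]

theorem mulVec_add_const_of_mem_rowStochastic (hA : A ∈ rowStochastic ℝ ι) (x : ι → ℝ) (c : ℝ)
    (i : ι) : (A *ᵥ fun j => x j + c) i = (A *ᵥ x) i + c := by
  rw [show (fun j => x j + c) = x + fun _ => c from rfl, mulVec_add, Pi.add_apply,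
    mulVec_const_of_mem_rowStochastic hA]

theorem mulVec_le_of_mem_rowStochastic (hA : A ∈ rowStochastic ℝ ι) {x : ι → ℝ} {c : ℝ}
    (h : ∀ i, x i ≤ c) (i : ι) : (A *ᵥ x) i ≤ c :=
  (mulVec_mono_of_mem_rowStochastic hA h i).trans_eq (mulVec_const_of_mem_rowStochastic hA c i)

theorem le_mulVec_of_mem_rowStochastic (hA : A ∈ rowStochastic ℝ ι) {x : ι → ℝ} {c : ℝ}
    (h : ∀ i, c ≤ x i) (i : ι) : c ≤ (A *ᵥ x) i :=
  (mulVec_const_of_mem_rowStochastic hA c i).symm.trans_le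
    (mulVec_mono_of_mem_rowStochastic hA h i)

theorem mulVec_le_sub_of_mem_rowStochastic (hA : A ∈ rowStochastic ℝ ι) {x : ι → ℝ} {c δ : ℝ}
    (h : ∀ i, x i ≤ c) {i j : ι} (hδ : δ ≤ A i j) : (A *ᵥ x) i ≤ c - δ * (c - x j) := by
  have hsingle : A i j * (c - x j) ≤ ∑ k, A i k * (c - x k) :=
    Finset.single_le_sum (f := fun k => A i k * (c - x k))
      (fun k _ => mul_nonneg (hA.1 i k) (sub_nonneg.2 (h k))) (Finset.mem_univ j)
  have hsum : ∑ k, A i k * (c - x k) = c - (A *ᵥ x) i := by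
    simp only [mul_sub, Finset.sum_sub_distrib, ← Finset.sum_mul,
      sum_row_of_mem_rowStochastic hA, one_mul, mulVec, dotProduct]
  have := mul_le_mul_of_nonneg_right hδ (sub_nonneg.2 (h j))
  linarith

theorem le_pow_mulVec_add_of_mem_rowStochastic (hA : A ∈ rowStochastic ℝ ι) {x : ℕ → ι → ℝ}
    {ε : ℕ → ℝ} (h : ∀ l i, x (l + 1) i ≤ (A *ᵥ x l) i + ε l) (k l : ℕ) (i : ι) :
    x (l + k) i ≤ ((A ^ k) *ᵥ x l) i + ∑ j ∈ Finset.range k, ε (l + j) := by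
  induction k generalizing i with
  | zero => simp
  | succ k ih =>
    calc x (l + k + 1) i ≤ (A *ᵥ x (l + k)) i + ε (l + k) := h _ i
      _ ≤ (A *ᵥ fun j => ((A ^ k) *ᵥ x l) j + ∑ j ∈ Finset.range k, ε (l + j)) i + ε (l + k) := by
        gcongr; exact mulVec_mono_of_mem_rowStochastic hA ih i
      _ = _ := by
        rw [mulVec_add_const_of_mem_rowStochastic hA, mulVec_mulVec, ← pow_succ',
          Finset.sum_range_succ, add_assoc]

theorem isPrimitive_of_isIrreducible_of_diag_pos [Nonempty ι] (hA : A.IsIrreducible)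
    (hdiag : ∀ i, 0 < A i i) : A.IsPrimitive := by
  have hstep : ∀ {m n : ℕ}, m ≤ n → ∀ {i j}, 0 < (A ^ m) i j → 0 < (A ^ n) i j := by
    intro m n hmn i j hm
    induction n, hmn using Nat.le_induction with
    | base => exact hm
    | succ n _ ih =>
      rw [pow_succ, mul_apply]
      exact (mul_pos ih (hdiag j)).trans_le (Finset.single_le_sum
        (f := fun l => (A ^ n) i l * A l j)
        (fun l _ => mul_nonneg (pow_apply_nonneg hA.nonneg _ i l) (hA.nonneg l j))
        (Finset.mem_univ j))
  choose k hk0 hk using (isIrreducible_iff_exists_pow_pos hA.nonneg).1 hA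
  have hle : ∀ i j, k i j ≤ ∑ p : ι × ι, k p.1 p.2 := fun i j =>
    Finset.single_le_sum (f := fun p : ι × ι => k p.1 p.2) (fun _ _ => Nat.zero_le _)
      (Finset.mem_univ (i, j))
  obtain ⟨i₀⟩ := ‹Nonempty ι›
  exact ⟨hA.nonneg, _, (hk0 i₀ i₀).trans_le (hle i₀ i₀), fun i j => hstep (hle i j) (hk i j)⟩

theorem exists_forall_le_pow_of_isPrimitive (hA : A.IsPrimitive) :
    ∃ k > 0, ∃ δ > 0, ∀ i j, δ ≤ (A ^ k) i j := by
  obtain ⟨k, hk, hpos⟩ := hA.exists_pos_pow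
  rcases isEmpty_or_nonempty ι with _ | _
  · exact ⟨k, hk, 1, one_pos, fun i => isEmptyElim i⟩
  · obtain ⟨p, hp⟩ := Finite.exists_min fun p : ι × ι => (A ^ k) p.1 p.2
    exact ⟨k, hk, _, hpos p.1 p.2, fun i j => hp (i, j)⟩

-- In the time `k + 1` needed to reach every state, each state puts mass at least `δ` on the
-- state `j₀`, where a fixed fraction `1 - η` of the size of `y` is lost.
theorem expDecay_of_subharmonic_of_loss (hA : A ∈ rowStochastic ℝ ι)
    (hprim : A.IsPrimitive) {y w : ℕ → ι → ℝ} {ε : ℕ → ℝ} {η : ℝ} {j₀ : ι} (hε : ExpDecay ε)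
    (hη : η ∈ Set.Ico 0 1) (hy : ∀ l i, 0 ≤ y l i) (hyw : ∀ l i, y (l + 1) i ≤ (A *ᵥ w l) i)
    (hw : ∀ l i, w l i ≤ y l i + ε l) (hw₀ : ∀ l, w l j₀ ≤ η * y l j₀ + ε l) : ExpDecay y := by
  obtain ⟨k, -, δ, hδ0, hδ⟩ := exists_forall_le_pow_of_isPrimitive hprim
  have hAk := pow_mem hA (k + 1)
  have hδ' : ∀ i, δ ≤ (A ^ (k + 1)) i j₀ := fun i => by
    rw [pow_succ']
    exact le_mulVec_of_mem_rowStochastic hA (x := fun l => (A ^ k) l j₀) (fun l => hδ l j₀) i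
  have hsub : ∀ l i, y (l + 1) i ≤ (A *ᵥ y l) i + ε l := fun l i =>
    (hyw l i).trans <| (mulVec_mono_of_mem_rowStochastic hA (hw l) i).trans_eq
      (mulVec_add_const_of_mem_rowStochastic hA _ _ i)
  have hle : ∀ l i, y l i ≤ ‖y l‖ := fun l i => (le_abs_self _).trans (norm_le_pi_norm (y l) i)
  set s : ℕ → ℝ := fun l => ∑ j ∈ Finset.range k, ε (l + 1 + j)
  have hs : ExpDecay s := .sum _ fun j _ => by simpa only [add_assoc] using hε.comp_add (1 + j)
  have hrec : ∀ l i, y (l + (k + 1)) i ≤ (1 - δ * (1 - η)) * ‖y l‖ + (ε l + s l) := fun l i => by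
    have hw_le : ∀ i, w l i ≤ ‖y l‖ + ε l := fun i => (hw l i).trans (by gcongr; exact hle l i)
    have hw₀_le : w l j₀ ≤ η * ‖y l‖ + ε l :=
      (hw₀ l).trans (by gcongr; exacts [hη.1, hle l j₀])
    have hiter : y (l + (k + 1)) i ≤ ((A ^ (k + 1)) *ᵥ w l) i + s l := by
      rw [pow_succ, ← mulVec_mulVec, add_comm k, ← add_assoc]
      refine (le_pow_mulVec_add_of_mem_rowStochastic hA hsub k (l + 1) i).trans ?_
      gcongr
      exact mulVec_mono_of_mem_rowStochastic (pow_mem hA k) (hyw l) i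
    have habs := mulVec_le_sub_of_mem_rowStochastic hAk hw_le (hδ' i)
    have := mul_le_mul_of_nonneg_left hw₀_le hδ0.le
    linarith
  have hδ1 : δ ≤ 1 := (hδ' j₀).trans (le_one_of_mem_rowStochastic hAk)
  have hρ : 1 - δ * (1 - η) ∈ Set.Ico 0 1 :=
    ⟨by nlinarith [hη.1, hη.2], by nlinarith [mul_pos hδ0 (sub_pos.2 hη.2)]⟩
  refine .of_delayed_contraction k.succ_pos hρ (hε.add hs) fun l => ?_
  rw [pi_norm_le_iff_of_nonneg ((hy _ j₀).trans (hrec l j₀))]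
  intro i
  rw [Real.norm_of_nonneg (hy _ i)]
  exact hrec l i

variable [Nonempty ι]

theorem one_sub_mem_Ico_of_mem_rowStochastic (hA : A ∈ rowStochastic ℝ ι) {δ : ℝ} (hδ : 0 < δ)
    (h : ∀ i j, δ ≤ A i j) : 1 - δ ∈ Set.Ico 0 1 :=
  let ⟨i⟩ := ‹Nonempty ι›
  ⟨sub_nonneg.2 ((h i i).trans (le_one_of_mem_rowStochastic hA)), sub_lt_self 1 hδ⟩

-- Over `k` steps with `δ ≤ A ^ k` the maximum drops by `δ` times the oscillation, so the
-- oscillation contracts by the factor `1 - δ`.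
theorem expDecay_iSup_sub_iInf_of_subharmonic (hA : A ∈ rowStochastic ℝ ι) (hprim : A.IsPrimitive)
    {x : ℕ → ι → ℝ} {ε : ℕ → ℝ} (hε : ExpDecay ε)
    (hsub : ∀ l i, x (l + 1) i ≤ (A *ᵥ x l) i + ε l)
    (hlow : ∀ l i, (⨅ j, x l j) - ε l ≤ x (l + 1) i) :
    ExpDecay fun l => (⨆ i, x l i) - ⨅ i, x l i := by
  obtain ⟨k, hk, δ, hδ0, hδ⟩ := exists_forall_le_pow_of_isPrimitive hprim
  have hAk := pow_mem hA k
  have hsup : ∀ l i, x l i ≤ ⨆ j, x l j := fun l => le_ciSup (Finite.bddAbove_range _)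
  have hinf : ∀ l i, ⨅ j, x l j ≤ x l i := fun l => ciInf_le (Finite.bddBelow_range _)
  set s : ℕ → ℝ := fun l => ∑ j ∈ Finset.range k, ε (l + j)
  have hlow_iter : ∀ l m, (⨅ i, x l i) - ∑ j ∈ Finset.range m, ε (l + j) ≤ ⨅ i, x (l + m) i := by
    intro l m
    induction m with
    | zero => simp
    | succ m ih =>
      rw [Finset.sum_range_succ, ← sub_sub]
      exact le_ciInf fun i => (sub_le_sub_right ih _).trans (hlow (l + m) i)
  have hup_iter : ∀ l, ⨆ i, x (l + k) i ≤
      (⨆ i, x l i) - δ * ((⨆ i, x l i) - ⨅ i, x l i) + s l := fun l => by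
    obtain ⟨j, hj⟩ := exists_eq_ciInf_of_finite (f := x l)
    refine ciSup_le fun i => (le_pow_mulVec_add_of_mem_rowStochastic hA hsub k l i).trans ?_
    rw [← hj]
    gcongr
    exact mulVec_le_sub_of_mem_rowStochastic hAk (hsup l) (hδ i j)
  have hosc : ∀ l, 0 ≤ (⨆ i, x l i) - ⨅ i, x l i := fun l =>
    sub_nonneg.2 ((hinf l (Classical.arbitrary ι)).trans (hsup l _))
  have hs_decay : ExpDecay s := .sum _ fun j _ => hε.comp_add j
  refine .of_delayed_contraction hk (one_sub_mem_Ico_of_mem_rowStochastic hAk hδ0 hδ)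
    (hs_decay.add hs_decay) fun l => ?_
  rw [Real.norm_of_nonneg (hosc _), Real.norm_of_nonneg (hosc _)]
  linarith [hlow_iter l k, hup_iter l]

theorem exists_expDecay_sub_of_subharmonic (hA : A ∈ rowStochastic ℝ ι) (hprim : A.IsPrimitive)
    {x : ℕ → ι → ℝ} {ε : ℕ → ℝ} (hε : ExpDecay ε)
    (hsub : ∀ l i, x (l + 1) i ≤ (A *ᵥ x l) i + ε l)
    (hlow : ∀ l i, (⨅ j, x l j) - ε l ≤ x (l + 1) i) :
    ∃ κ : ℝ, ExpDecay fun l i => x l i - κ := by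
  have hosc := expDecay_iSup_sub_iInf_of_subharmonic hA hprim hε hsub hlow
  have hsup : ∀ l i, x l i ≤ ⨆ j, x l j := fun l => le_ciSup (Finite.bddAbove_range _)
  have hinf : ∀ l i, ⨅ j, x l j ≤ x l i := fun l => ciInf_le (Finite.bddBelow_range _)
  have hstep : ExpDecay fun l => (⨅ i, x (l + 1) i) - ⨅ i, x l i := by
    refine hosc.of_norm_le_add hε fun l => ?_
    have hlo : (⨅ i, x l i) - ε l ≤ ⨅ i, x (l + 1) i := le_ciInf (hlow l)
    have hhi : ⨅ i, x (l + 1) i ≤ (⨆ i, x l i) + ε l := by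
      refine (hinf (l + 1) (Classical.arbitrary ι)).trans ((hsub l _).trans ?_)
      gcongr
      exact mulVec_le_of_mem_rowStochastic hA (hsup l) _
    simp only [Real.norm_eq_abs]
    rw [abs_le]
    constructor <;>
      linarith [le_abs_self (ε l), le_abs_self ((⨆ i, x l i) - ⨅ i, x l i),
        abs_nonneg ((⨆ i, x l i) - ⨅ i, x l i)]
  obtain ⟨κ, hκ⟩ := ExpDecay.exists_limit (f := fun l => ⨅ i, x l i) hstep
  refine ⟨κ, ExpDecay.pi fun i => hosc.of_norm_le_add hκ fun l => ?_⟩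
  simp only [Real.norm_eq_abs]
  rw [abs_le]
  constructor <;>
    linarith [hsup l i, hinf l i, le_abs_self ((⨆ i, x l i) - ⨅ i, x l i),
      neg_abs_le ((⨅ i, x l i) - κ), le_abs_self ((⨅ i, x l i) - κ)]

theorem exists_expDecay_sub_of_perturbed_average (hA : A ∈ rowStochastic ℝ ι)
    (hprim : A.IsPrimitive) {x e : ℕ → ι → ℝ} (hx : ∀ l, x (l + 1) = A *ᵥ x l + e l)
    (he : ExpDecay e) : ∃ κ : ℝ, ExpDecay fun l i => x l i - κ := by
  have hle : ∀ l i, |e l i| ≤ ‖e l‖ := fun l => norm_le_pi_norm (e l)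
  refine exists_expDecay_sub_of_subharmonic hA hprim he.norm (fun l i => ?_) fun l i => ?_
  · rw [hx, Pi.add_apply]
    gcongr
    exact (le_abs_self _).trans (hle l i)
  · have hinf : ⨅ j, x l j ≤ (A *ᵥ x l) i :=
      le_mulVec_of_mem_rowStochastic hA (ciInf_le (Finite.bddBelow_range _)) i
    rw [hx, Pi.add_apply]
    linarith [neg_abs_le (e l i), hle l i]

end Stochastic

section LinearGrowth

open Matrix Asymptotics Filter

theorem exists_forall_norm_le_of_relative_perturbation {E : Type*} [SeminormedAddCommGroup E]
    {x : ℕ → E} {η : ℕ → ℝ} (hη : ExpDecay η)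
    (hx : ∀ l, ‖x (l + 1)‖ ≤ ‖x l‖ + η l * (1 + ‖x l‖)) : ∃ K, ∀ l, ‖x l‖ ≤ K := by
  have hstep : ∀ l ≥ 0, 1 + ‖x (l + 1)‖ ≤ (1 + ‖η l‖) * (1 + ‖x l‖) + 0 := fun l _ => by
    have : η l * (1 + ‖x l‖) ≤ ‖η l‖ * (1 + ‖x l‖) := by gcongr; exact Real.le_norm_self _
    linarith [hx l]
  refine ⟨(1 + ‖x 0‖) * Real.exp (∑' l, ‖η l‖), fun l => ?_⟩
  calc ‖x l‖ ≤ 1 + ‖x l‖ := by linarith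
    _ ≤ (1 + ‖x 0‖ + ∑ _k ∈ Finset.Ico 0 l, 0) * Real.exp (∑ i ∈ Finset.Ico 0 l, ‖η i‖) :=
      discrete_gronwall (u := fun l => 1 + ‖x l‖) (by positivity) hstep
        (fun _ _ => norm_nonneg _) (fun _ _ => le_rfl) l.zero_le
    _ ≤ (1 + ‖x 0‖) * Real.exp (∑' l, ‖η l‖) := by
      rw [Finset.sum_const_zero, add_zero]
      gcongr
      exact hη.summable_norm.sum_le_tsum _ fun _ _ => norm_nonneg _

theorem exists_relative_error_of_affine_chain {E : Type*} [NormedRing E] {T D S : ℕ → ℕ → E}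
    {c : E} (hT : ∀ l r, T l (r + 1) = T l r * D l r + S l r)
    {r : ℕ} (hD : ∀ s < r, ExpDecay fun l => D l s - 1)
    (hS : ∀ s < r, ExpDecay fun l => S l s - c) :
    ∃ η : ℕ → ℝ, ExpDecay η ∧ ∀ l, ‖T l r - T l 0 - r • c‖ ≤ η l * (1 + ‖T l 0‖) := by
  induction r with
  | zero => exact ⟨fun _ => 0, .zero, fun l => by simp⟩
  | succ r ih =>
    obtain ⟨η, hη, hle⟩ := ih (fun s hs => hD s (hs.trans r.lt_succ_self))
      fun s hs => hS s (hs.trans r.lt_succ_self)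
    replace hD := hD r r.lt_succ_self
    replace hS := hS r r.lt_succ_self
    have hDbdd : (fun l => ‖D l r‖) =O[atTop] fun _ => (1 : ℝ) := by
      have : Tendsto (fun l => D l r) atTop (nhds 1) := by
        simpa using hD.tendsto_zero.add_const 1
      exact (this.isBigO_one ℝ).norm_left
    refine ⟨fun l => η l * ‖D l r‖ + ((1 + ‖r • c‖) * ‖D l r - 1‖ + ‖S l r - c‖),
      (hη.mul_isBigO_one hDbdd).add ((hD.norm.of_norm_le (1 + ‖r • c‖) fun l => ?_).add
        hS.norm), fun l => ?_⟩
    · rw [norm_mul, Real.norm_of_nonneg (by positivity : 0 ≤ 1 + ‖r • c‖)]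
    have hsplit : T l (r + 1) - T l 0 - (r + 1) • c =
        (T l r - T l 0 - r • c) * D l r + ((T l 0 + r • c) * (D l r - 1) + (S l r - c)) := by
      rw [hT, add_smul, one_smul]; noncomm_ring
    have hmid : ‖T l 0 + r • c‖ ≤ (1 + ‖r • c‖) * (1 + ‖T l 0‖) := by
      nlinarith [norm_add_le (T l 0) (r • c), norm_nonneg (r • c), norm_nonneg (T l 0)]
    calc ‖T l (r + 1) - T l 0 - (r + 1) • c‖
        ≤ ‖T l r - T l 0 - r • c‖ * ‖D l r‖ + (‖T l 0 + r • c‖ * ‖D l r - 1‖ + ‖S l r - c‖) := by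
          rw [hsplit]
          exact norm_add_le_of_le (norm_mul_le _ _)
            (norm_add_le_of_le (norm_mul_le _ _) le_rfl)
      _ ≤ η l * (1 + ‖T l 0‖) * ‖D l r‖ + ((1 + ‖r • c‖) * (1 + ‖T l 0‖) * ‖D l r - 1‖ +
            ‖S l r - c‖ * (1 + ‖T l 0‖)) := by
          gcongr
          · exact hle l
          · exact le_mul_of_one_le_right (norm_nonneg _) (by simp)
      _ = _ := by ring

theorem norm_mulVec_le_of_mem_rowStochastic {ι : Type*} [Fintype ι] [DecidableEq ι]
    {A : Matrix ι ι ℝ} (hA : A ∈ rowStochastic ℝ ι) (x : ι → ℝ) : ‖A *ᵥ x‖ ≤ ‖x‖ := by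
  refine (pi_norm_le_iff_of_nonneg (norm_nonneg _)).2 fun i => abs_le.2 ⟨?_, ?_⟩
  · exact le_mulVec_of_mem_rowStochastic hA (fun j => (abs_le.1 (norm_le_pi_norm x j)).1) i
  · exact mulVec_le_of_mem_rowStochastic hA (fun j => (abs_le.1 (norm_le_pi_norm x j)).2) i

variable {ι : Type*} [Fintype ι] [DecidableEq ι] [Nonempty ι] {A : Matrix ι ι ℝ}

theorem exists_expDecay_sub_of_relative_perturbation (hA : A ∈ rowStochastic ℝ ι)
    (hprim : A.IsPrimitive) {x e : ℕ → ι → ℝ} {η : ℕ → ℝ} (hx : ∀ l, x (l + 1) = A *ᵥ x l + e l)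
    (hη : ExpDecay η) (he : ∀ l, ‖e l‖ ≤ η l * (1 + ‖x l‖)) :
    ∃ κ : ℝ, ExpDecay fun l i => x l i - κ := by
  obtain ⟨K, hK⟩ := exists_forall_norm_le_of_relative_perturbation (x := x) hη fun l => by
    rw [hx]
    exact norm_add_le_of_le (norm_mulVec_le_of_mem_rowStochastic hA _) (he l)
  refine exists_expDecay_sub_of_perturbed_average hA hprim hx (hη.of_norm_le (1 + K) fun l => ?_)
  calc ‖e l‖ ≤ η l * (1 + ‖x l‖) := he l
    _ ≤ ‖η l‖ * (1 + K) := by gcongr; exacts [Real.le_norm_self _, hK l]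
    _ = (1 + K) * ‖η l‖ := mul_comm _ _

theorem exists_relative_error_of_drift {E F : Type*} [SeminormedAddCommGroup E]
    [SeminormedAddCommGroup F] {x y : ℕ → E} {e : ℕ → F} {η : ℕ → ℝ} {K : ℝ} (hη : ExpDecay η)
    (hxy : ∀ l : ℕ, ‖y l - x l‖ ≤ K * l) (he : ∀ l, ‖e l‖ ≤ η l * (1 + ‖y l‖)) :
    ∃ η' : ℕ → ℝ, ExpDecay η' ∧ ∀ l, ‖e l‖ ≤ η' l * (1 + ‖x l‖) := by
  refine ⟨fun l => ‖η l‖ + |K| * (l * ‖η l‖),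
    hη.norm.add (hη.norm.natCast_mul.of_norm_le |K| fun l => by simp), fun l => ?_⟩
  have hy : ‖y l‖ ≤ ‖x l‖ + |K| * l :=
    (norm_le_norm_add_norm_sub' _ _).trans <| by
      gcongr; exact (hxy l).trans (by gcongr; exact le_abs_self K)
  have hKl : 0 ≤ |K| * l := by positivity
  calc ‖e l‖ ≤ η l * (1 + ‖y l‖) := he l
    _ ≤ ‖η l‖ * ((1 + |K| * l) * (1 + ‖x l‖)) := by
      gcongr
      · exact Real.le_norm_self _
      · nlinarith [norm_nonneg (x l)]
    _ = _ := by ring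

-- After subtracting the drift `R l c`, one round of affine maps followed by averaging is a
-- perturbed average whose error is small relative to the iterate.
theorem exists_linear_growth_of_affine_chain (hA : A ∈ rowStochastic ℝ ι) (hprim : A.IsPrimitive)
    {R : ℕ} {c : ℝ} {T D S : ℕ → ℕ → ι → ℝ} (hT₀ : ∀ l, T (l + 1) 0 = A *ᵥ T l R)
    (hT : ∀ l r, T l (r + 1) = T l r * D l r + S l r) (hD : ∀ r < R, ExpDecay fun l => D l r - 1)
    (hS : ∀ r < R, ExpDecay fun l => S l r - Function.const ι c) :
    ∃ κ : ℝ, ∀ r ≤ R, ExpDecay fun l i => T l r i - (R * l * c + (κ + r * c)) := by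
  set x : ℕ → ι → ℝ := fun l i => T l 0 i - R * l * c with hx
  set e : ℕ → ℕ → ι → ℝ := fun r l => T l r - T l 0 - r • Function.const ι c
  have he_apply : ∀ r l i, e r l i = T l r i - T l 0 i - r * c := fun r l i => by
    rw [← nsmul_eq_mul]; rfl
  have hdrift : ∀ l : ℕ, ‖T l 0 - x l‖ ≤ |R * c| * l := fun l => by
    rw [show T l 0 - x l = Function.const ι (R * l * c) by ext i; simp [hx]]
    exact (pi_norm_const_le ((R : ℝ) * l * c)).trans_eq
      (by rw [mul_right_comm, norm_mul, Real.norm_natCast, Real.norm_eq_abs])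
  have hrel : ∀ r ≤ R, ∃ η : ℕ → ℝ, ExpDecay η ∧ ∀ l, ‖e r l‖ ≤ η l * (1 + ‖x l‖) := fun r hr =>
    let ⟨_, hη, hle⟩ := exists_relative_error_of_affine_chain hT
      (fun s hs => hD s (hs.trans_le hr)) fun s hs => hS s (hs.trans_le hr)
    exists_relative_error_of_drift hη hdrift hle
  have hrec : ∀ l, x (l + 1) = A *ᵥ x l + A *ᵥ e R l := fun l => by
    rw [← mulVec_add, show x l + e R l = fun i => T l R i + -(R * l * c + R * c) by
      funext i; rw [Pi.add_apply, he_apply]; ring]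
    ext i
    rw [mulVec_add_const_of_mem_rowStochastic hA, ← hT₀]
    simp only [hx]; push_cast; ring
  obtain ⟨η, hη, hle⟩ := hrel R le_rfl
  obtain ⟨κ, hκ⟩ := exists_expDecay_sub_of_relative_perturbation hA hprim hrec hη fun l =>
    (norm_mulVec_le_of_mem_rowStochastic hA _).trans (hle l)
  have hbdd : (fun l => 1 + ‖x l‖) =O[atTop] fun _ => (1 : ℝ) := by
    have := (hκ.tendsto_zero.add_const (Function.const ι κ)).norm.const_add 1
    refine (this.congr fun l => ?_).isBigO_one ℝ
    congr 2; ext i; simp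
  refine ⟨κ, fun r hr => ?_⟩
  obtain ⟨η, hη, hle⟩ := hrel r hr
  refine hκ.of_norm_le_add (hη.mul_isBigO_one hbdd) fun l => ?_
  rw [show (fun i => T l r i - (R * l * c + (κ + r * c))) = (fun i => x l i - κ) + e r l by
    ext i; rw [Pi.add_apply, he_apply]; ring]
  exact norm_add_le_of_le le_rfl ((hle l).trans (Real.le_norm_self _))

end LinearGrowth

section Graph

open Matrix

variable {V : Type*} [Fintype V] [DecidableEq V] (G : SimpleGraph V) [DecidableRel G.Adj]

theorem avgMatrix_mem_rowStochastic : avgMatrix G ∈ rowStochastic ℝ V := by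
  refine mem_rowStochastic_iff_sum.2 ⟨fun u v => ?_, fun u => ?_⟩
  · simp only [avgMatrix, of_apply]
    split_ifs <;> positivity
  · have h : ∀ v, avgMatrix G u v =
        if v ∈ insert u (G.neighborFinset u) then 1 / ((G.degree u : ℝ) + 1) else 0 := fun v => by
      simp [avgMatrix]
    simp_rw [h]
    rw [Finset.sum_ite_mem, Finset.univ_inter, Finset.sum_const,
      Finset.card_insert_of_notMem (by simp), SimpleGraph.card_neighborFinset_eq_degree,
      nsmul_eq_mul]
    push_cast
    exact mul_one_div_cancel (by positivity)

theorem aggMatrix_mem_rowStochastic : aggMatrix G ∈ rowStochastic ℝ (V × V) := by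
  have h := mem_rowStochastic_iff_sum.1 (avgMatrix_mem_rowStochastic G)
  refine mem_rowStochastic_iff_sum.2 ⟨fun p q => mul_nonneg (h.1 _ _) (h.1 _ _), fun p => ?_⟩
  simp only [aggMatrix, kroneckerMap_apply, Fintype.sum_prod_type, ← Finset.mul_sum, h.2, mul_one]

theorem aggMatrix_diag_pos (p : V × V) : 0 < aggMatrix G p p := by
  simp only [aggMatrix, kroneckerMap_apply, avgMatrix, of_apply, true_or, if_true]
  positivity

theorem isPrimitive_aggMatrix [Nonempty V] (hirr : (aggMatrix G).IsIrreducible) :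
    (aggMatrix G).IsPrimitive :=
  isPrimitive_of_isIrreducible_of_diag_pos hirr (aggMatrix_diag_pos G)

theorem of_aggregate (S : V → V → ℝ) :
    Matrix.of (aggregate G S) = avgMatrix G * Matrix.of S * (avgMatrix G)ᵀ := by
  ext u u'
  simp only [of_apply, mul_apply, transpose_apply, ← aggMatrix_mulVec G S (u, u'), mulVec,
    dotProduct, aggMatrix, kroneckerMap_apply, Fintype.sum_prod_type, Finset.sum_mul]
  rw [Finset.sum_comm]
  refine Finset.sum_congr rfl fun v' _ => Finset.sum_congr rfl fun v _ => ?_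
  ring

theorem posSemidef_aggregate {S : V → V → ℝ} (hS : (Matrix.of S).PosSemidef) :
    (Matrix.of (aggregate G S)).PosSemidef := by
  rw [of_aggregate, ← conjTranspose_eq_transpose_of_trivial]
  exact hS.mul_mul_conjTranspose_same _

theorem aggregate_le {S : V → V → ℝ} {c : ℝ} (h : ∀ u u', S u u' ≤ c) (u u' : V) :
    aggregate G S u u' ≤ c := by
  rw [← aggMatrix_mulVec G S (u, u')]
  exact mulVec_le_of_mem_rowStochastic (aggMatrix_mem_rowStochastic G) (fun p => h p.1 p.2) _

theorem le_aggregate {S : V → V → ℝ} {c : ℝ} (h : ∀ u u', c ≤ S u u') (u u' : V) :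
    c ≤ aggregate G S u u' := by
  rw [← aggMatrix_mulVec G S (u, u')]
  exact le_mulVec_of_mem_rowStochastic (aggMatrix_mem_rowStochastic G) (fun p => h p.1 p.2) _

variable {G} {d : ℕ} {h : V → EuclideanSpace ℝ (Fin d)} {φ : ℝ → ℝ} {σw σb : ℝ} {R : ℕ}

theorem gpk_zero_zero (u u' : V) : gpk G h φ σw σb R 0 0 u u' = inner ℝ (h u) (h u') := by
  simp only [gpk]

theorem gpk_succ_zero (l : ℕ) :
    gpk G h φ σw σb R (l + 1) 0 = aggregate G (gpk G h φ σw σb R l R) := by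
  simp only [gpk]

theorem gpk_succ (l r : ℕ) :
    gpk G h φ σw σb R l (r + 1) = covStep φ σw σb (gpk G h φ σw σb R l r) := by
  cases l <;> simp only [gpk]

theorem gntk_succ_zero (l : ℕ) :
    gntk G h φ σw σb R (l + 1) 0 = aggregate G (gntk G h φ σw σb R l R) := by
  simp only [gntk]

theorem gntk_succ (l r : ℕ) (u u' : V) :
    gntk G h φ σw σb R l (r + 1) u u' = gntk G h φ σw σb R l r u u' *
      covDotStep φ σw (gpk G h φ σw σb R l r) u u' + gpk G h φ σw σb R l (r + 1) u u' := by
  cases l <;> simp only [gntk]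

@[elab_as_elim]
theorem layer_induction {R : ℕ} {p : ℕ → ℕ → Prop} (hzero : p 0 0)
    (hnext : ∀ l, p l R → p (l + 1) 0) (hstep : ∀ l r, p l r → p l (r + 1)) (l r : ℕ) : p l r := by
  have hlayer (l : ℕ) (h₀ : p l 0) (r : ℕ) : p l r := Nat.rec h₀ (fun r => hstep l r) r
  exact hlayer l (Nat.rec hzero (fun l h₀ => hnext l (hlayer l h₀ R)) l) r

theorem gpk_induction {p : (V → V → ℝ) → Prop} (hinner : p fun u u' => inner ℝ (h u) (h u'))
    (hagg : ∀ S, p S → p (aggregate G S)) (hstep : ∀ S, p S → p (covStep φ σw σb S)) (l r : ℕ) :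
    p (gpk G h φ σw σb R l r) := by
  refine layer_induction (R := R) ?_ (fun l hl => ?_) (fun l r hr => ?_) l r
  · simpa only [gpk] using hinner
  · rw [gpk_succ_zero]
    exact hagg _ hl
  · rw [gpk_succ]
    exact hstep _ hr

theorem exists_linear_growth_gntk [Nonempty V] (hirr : (aggMatrix G).IsIrreducible) {c : ℝ}
    (hdot : ∀ r < R, ExpDecay fun l (p : V × V) =>
      covDotStep φ σw (gpk G h φ σw σb R l r) p.1 p.2 - 1)
    (hcov : ∀ r < R, ExpDecay fun l (p : V × V) => gpk G h φ σw σb R l (r + 1) p.1 p.2 - c) :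
    ∃ κ : ℝ, ∀ r ≤ R, ExpDecay fun l (p : V × V) =>
      gntk G h φ σw σb R l r p.1 p.2 - (R * l * c + (κ + r * c)) := by
  refine exists_linear_growth_of_affine_chain (aggMatrix_mem_rowStochastic G)
    (isPrimitive_aggMatrix G hirr) (T := fun l r p => gntk G h φ σw σb R l r p.1 p.2)
    (S := fun l r p => gpk G h φ σw σb R l (r + 1) p.1 p.2) (fun l => funext fun p => ?_)
    (fun l r => funext fun p => gntk_succ l r p.1 p.2) hdot hcov
  rw [aggMatrix_mulVec, gntk_succ_zero]

end Graph

section GaussianPairs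

open Matrix

theorem map_mulVec_multivariateGaussian {ι κ : Type*} [Fintype ι] [DecidableEq ι] [Fintype κ]
    [DecidableEq κ] {S : Matrix ι ι ℝ} (hS : S.PosSemidef) (A : Matrix κ ι ℝ) :
    (multivariateGaussian 0 S).map (fun z : EuclideanSpace ℝ ι => WithLp.toLp 2 (A *ᵥ z.ofLp)) =
      multivariateGaussian 0 (A * S * Aᵀ) := by
  have hA : Measurable fun z : EuclideanSpace ℝ ι => WithLp.toLp 2 (A *ᵥ z.ofLp) := by
    unfold mulVec dotProduct
    fun_prop
  have := Measure.isProbabilityMeasure_map (μ := multivariateGaussian 0 S) hA.aemeasurable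
  have hAS : (A * S * Aᵀ).PosSemidef := by
    rw [← conjTranspose_eq_transpose_of_trivial]
    exact hS.mul_mul_conjTranspose_same A
  have hinner : ∀ (z : EuclideanSpace ℝ ι) (t : EuclideanSpace ℝ κ),
      inner ℝ (WithLp.toLp 2 (A *ᵥ z.ofLp)) t = inner ℝ z (WithLp.toLp 2 (Aᵀ *ᵥ t.ofLp)) :=
    fun z t => by
      simp only [EuclideanSpace.inner_eq_star_dotProduct, star_trivial, mulVec_transpose,
        dotProduct_mulVec]
  refine Measure.ext_of_charFun (funext fun t => ?_)
  rw [charFun_apply, integral_map hA.aemeasurable (by fun_prop)]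
  simp_rw [hinner]
  rw [← charFun_apply, charFun_multivariateGaussian hS, charFun_multivariateGaussian hAS]
  simp only [inner_zero_right, ← mulVec_mulVec, dotProduct_mulVec, mulVec_transpose]

theorem map_gaussianReal_prod_eq_multivariateGaussian (p q r s : ℝ) :
    ((gaussianReal 0 1).prod (gaussianReal 0 1)).map
        (fun w : ℝ × ℝ => !₂[p * w.1 + q * w.2, r * w.1 + s * w.2]) =
      multivariateGaussian 0
        !![p ^ 2 + q ^ 2, p * r + q * s; p * r + q * s, r ^ 2 + s ^ 2] := by
  have hcov : !![p ^ 2 + q ^ 2, p * r + q * s; p * r + q * s, r ^ 2 + s ^ 2] =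
      !![p, q; r, s] * 1 * !![p, q; r, s]ᵀ := by
    ext i j
    fin_cases i <;> fin_cases j <;> simp [mul_apply, Fin.sum_univ_two] <;> ring
  rw [hcov, ← map_mulVec_multivariateGaussian .one, multivariateGaussian_zero_one,
    ← map_pi_eq_stdGaussian, ← (measurePreserving_finTwoArrow _).map_eq,
    Measure.map_map (by fun_prop) (by fun_prop), Measure.map_map _ (by fun_prop)]
  · congr 1
    ext w i
    fin_cases i <;> simp [dotProduct, Fin.sum_univ_two, MeasurableEquiv.finTwoArrow]
  · unfold mulVec dotProduct
    fun_prop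

theorem map_eval_pair_multivariateGaussian {V : Type*} [Fintype V] [DecidableEq V]
    {S : Matrix V V ℝ} (hS : S.PosSemidef) (u u' : V) :
    (multivariateGaussian 0 S).map (fun z => (!₂[z u, z u'] : EuclideanSpace ℝ (Fin 2))) =
      multivariateGaussian 0 !![S u u, S u u'; S u' u, S u' u'] := by
  have hcov : !![S u u, S u u'; S u' u, S u' u'] =
      (1 : Matrix V V ℝ).submatrix ![u, u'] (Equiv.refl V) * S *
        ((1 : Matrix V V ℝ).submatrix ![u, u'] (Equiv.refl V))ᵀ := by
    rw [transpose_submatrix, transpose_one, one_submatrix_mul, mul_submatrix_one]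
    ext i j
    fin_cases i <;> fin_cases j <;> rfl
  rw [hcov, ← map_mulVec_multivariateGaussian hS]
  congr 1 with z i
  fin_cases i <;> exact (congrFun (one_mulVec z.ofLp) _).symm

/-- `𝔼[ψ(z₁) ψ(z₂)]` for a centred Gaussian pair with variances `a`, `d` and covariance `b`. -/
noncomputable def pairExp (ψ : ℝ → ℝ) (a b d : ℝ) : ℝ :=
  ∫ z, ψ (z 0) * ψ (z 1) ∂(multivariateGaussian (0 : EuclideanSpace ℝ (Fin 2)) !![a, b; b, d])

theorem pairExp_eq_integral_prod {ψ : ℝ → ℝ} (hψ : Measurable ψ) {p q r s a b d : ℝ}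
    (ha : a = p ^ 2 + q ^ 2) (hb : b = p * r + q * s) (hd : d = r ^ 2 + s ^ 2) :
    pairExp ψ a b d = ∫ w, ψ (p * w.1 + q * w.2) * ψ (r * w.1 + s * w.2)
      ∂((gaussianReal 0 1).prod (gaussianReal 0 1)) := by
  rw [pairExp, ha, hb, hd, ← map_gaussianReal_prod_eq_multivariateGaussian,
    integral_map (by fun_prop)]
  · rfl
  · exact (by fun_prop : Measurable fun z : EuclideanSpace ℝ (Fin 2) =>
      ψ (z 0) * ψ (z 1)).aestronglyMeasurable

theorem exists_pair_factorization {a b d : ℝ} (ha : 0 ≤ a) (hd : 0 ≤ d) (h : b ^ 2 ≤ a * d) :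
    ∃ p r s : ℝ, a = p ^ 2 ∧ b = p * r ∧ d = r ^ 2 + s ^ 2 := by
  rcases ha.eq_or_lt with rfl | ha
  · have hb : b = 0 := pow_eq_zero_iff two_ne_zero |>.1 <|
      le_antisymm (h.trans_eq (zero_mul d)) (sq_nonneg b)
    exact ⟨0, 0, √d, by simp, by simp [hb], by simp [Real.sq_sqrt hd]⟩
  · have hle : 0 ≤ d - b ^ 2 / a := by
      rw [sub_nonneg, div_le_iff₀ ha]; linarith
    refine ⟨√a, b / √a, √(d - b ^ 2 / a), (Real.sq_sqrt ha.le).symm, ?_, ?_⟩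
    · rw [mul_div_cancel₀ _ (Real.sqrt_ne_zero'.2 ha)]
    · rw [Real.sq_sqrt hle, div_pow, Real.sq_sqrt ha.le]; ring

theorem pairExp_comm {ψ : ℝ → ℝ} (hψ : Measurable ψ) {a b d : ℝ} (ha : 0 ≤ a) (hd : 0 ≤ d)
    (h : b ^ 2 ≤ a * d) : pairExp ψ a b d = pairExp ψ d b a := by
  obtain ⟨p, r, s, rfl, rfl, rfl⟩ := exists_pair_factorization ha hd h
  rw [pairExp_eq_integral_prod (p := p) (q := 0) (r := r) (s := s) hψ (by ring) (by ring) rfl,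
    pairExp_eq_integral_prod (p := r) (q := s) (r := p) (s := 0) hψ rfl (by ring) (by ring)]
  simp_rw [mul_comm]

theorem pairExp_self {ψ : ℝ → ℝ} (hψ : Measurable ψ) {a : ℝ} (ha : 0 ≤ a) :
    pairExp ψ a a a = ∫ x, ψ (√a * x) ^ 2 ∂(gaussianReal 0 1) := by
  have hsq : a = √a ^ 2 + 0 ^ 2 := by simp [Real.sq_sqrt ha]
  rw [pairExp_eq_integral_prod hψ hsq (by linarith) hsq]
  simp only [zero_mul, add_zero, ← sq]
  exact (integral_fun_fst fun x => ψ (√a * x) ^ 2).trans (by simp)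

theorem covStep_eq_pairExp {V : Type*} (φ : ℝ → ℝ) (σw σb : ℝ) {S : V → V → ℝ} {u u' : V}
    (h : S u' u = S u u') :
    covStep φ σw σb S u u' = σw ^ 2 * pairExp φ (S u u) (S u u') (S u' u') + σb ^ 2 := by
  rw [covStep, pairGaussian, h, pairExp]

theorem covDotStep_eq_pairExp {V : Type*} (φ : ℝ → ℝ) (σw : ℝ) {S : V → V → ℝ} {u u' : V}
    (h : S u' u = S u u') :
    covDotStep φ σw S u u' = σw ^ 2 * pairExp (deriv φ) (S u u) (S u u') (S u' u') := by
  rw [covDotStep, pairGaussian, h, pairExp]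

end GaussianPairs

section PosSemidef

open Matrix

variable {V : Type*} {S : V → V → ℝ}

theorem symm_of_posSemidef (hS : (Matrix.of S).PosSemidef) (u v : V) : S v u = S u v := by
  simpa using hS.isHermitian.apply u v

theorem diag_nonneg_of_posSemidef (hS : (Matrix.of S).PosSemidef) (u : V) : 0 ≤ S u u :=
  hS.diag_nonneg

theorem posSemidef_pair (hS : (Matrix.of S).PosSemidef) (u v : V) :
    !![S u u, S u v; S u v, S v v].PosSemidef := by
  have hsub : !![S u u, S u v; S u v, S v v] = (Matrix.of S).submatrix ![u, v] ![u, v] := by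
    ext i j
    fin_cases i <;> fin_cases j <;> simp [symm_of_posSemidef hS u v]
  exact hsub ▸ hS.submatrix _

theorem sq_le_mul_of_posSemidef (hS : (Matrix.of S).PosSemidef) (u v : V) :
    S u v ^ 2 ≤ S u u * S v v := by
  have h := (posSemidef_pair hS u v).det_nonneg
  rw [det_fin_two_of] at h
  linarith [sq (S u v)]

theorem posSemidef_of_integral_mul [Finite V] {Ω : Type*} [MeasurableSpace Ω] {μ : Measure Ω}
    {f : V → Ω → ℝ} (hf : ∀ u, MemLp (f u) 2 μ) :
    (Matrix.of fun u v => ∫ x, f u x * f v x ∂μ).PosSemidef := by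
  have hgram : (Matrix.of fun u v => ∫ x, f u x * f v x ∂μ) = gram ℝ fun u => (hf u).toLp := by
    ext u v
    rw [of_apply, gram_apply, L2.inner_def]
    refine integral_congr_ae ?_
    filter_upwards [(hf u).coeFn_toLp, (hf v).coeFn_toLp] with x hu hv
    rw [hu, hv]
    simp [mul_comm]
  exact hgram ▸ posSemidef_gram ℝ _

theorem memLp_comp_eval_multivariateGaussian [Fintype V] [DecidableEq V] {φ : ℝ → ℝ}
    (hφ : Measurable φ) (hle : ∀ x, |φ x| ≤ |x|) (m : EuclideanSpace ℝ V) (S : Matrix V V ℝ)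
    (u : V) : MemLp (fun z : EuclideanSpace ℝ V => φ (z u)) 2 (multivariateGaussian m S) :=
  (IsGaussian.memLp_two_id (μ := multivariateGaussian m S)).mono
    (hφ.comp (by fun_prop)).aestronglyMeasurable
    (ae_of_all _ fun z => (hle _).trans (PiLp.norm_apply_le z u))

theorem integral_mul_pairGaussian [Fintype V] [DecidableEq V] {φ : ℝ → ℝ} (hφ : Measurable φ)
    (hS : (Matrix.of S).PosSemidef) (u u' : V) :
    ∫ z, φ (z 0) * φ (z 1) ∂(pairGaussian S u u') =
      ∫ z, φ (z u) * φ (z u') ∂(multivariateGaussian 0 (Matrix.of S)) := by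
  have hmap := map_eval_pair_multivariateGaussian hS u u'
  simp only [of_apply] at hmap
  rw [pairGaussian, ← hmap, integral_map (by fun_prop)]
  · rfl
  · exact (by fun_prop : Measurable fun z : EuclideanSpace ℝ (Fin 2) =>
      φ (z 0) * φ (z 1)).aestronglyMeasurable

theorem posSemidef_covStep [Finite V] {φ : ℝ → ℝ} (hφ : Measurable φ) (hle : ∀ x, |φ x| ≤ |x|)
    (σw σb : ℝ) (hS : (Matrix.of S).PosSemidef) :
    (Matrix.of (covStep φ σw σb S)).PosSemidef := by
  classical
  have := Fintype.ofFinite V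
  have hLp := memLp_comp_eval_multivariateGaussian hφ hle 0 (Matrix.of S)
  have hbias : (Matrix.of fun _ _ : V => σb ^ 2).PosSemidef := by
    have hrank : (Matrix.of fun _ _ : V => σb ^ 2) =
        vecMulVec (fun _ => σb) (star fun _ => σb) := by
      ext u v
      simp [vecMulVec_apply, sq]
    exact hrank ▸ posSemidef_vecMulVec_self_star _
  have hsum : Matrix.of (covStep φ σw σb S) = σw ^ 2 • (Matrix.of fun u u' =>
      ∫ z : EuclideanSpace ℝ V, φ (z u) * φ (z u') ∂(multivariateGaussian 0 (Matrix.of S))) +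
        Matrix.of fun _ _ => σb ^ 2 := by
    ext u u'
    simp [covStep, integral_mul_pairGaussian hφ hS]
  exact hsum ▸ ((posSemidef_of_integral_mul hLp).smul (sq_nonneg σw)).add hbias

theorem posSemidef_gpk [Fintype V] [DecidableEq V] {G : SimpleGraph V} [DecidableRel G.Adj]
    {d : ℕ} {h : V → EuclideanSpace ℝ (Fin d)} {φ : ℝ → ℝ} {σw σb : ℝ} {R : ℕ} (hφ : Measurable φ)
    (hle : ∀ x, |φ x| ≤ |x|) (l r : ℕ) : (Matrix.of (gpk G h φ σw σb R l r)).PosSemidef :=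
  gpk_induction (p := fun S => (Matrix.of S).PosSemidef) (posSemidef_gram ℝ h)
    (fun _ => posSemidef_aggregate G) (fun _ => posSemidef_covStep hφ hle σw σb) l r

end PosSemidef

section GaussianMoments

open scoped NNReal

theorem integral_comp_neg_multivariateGaussian {ι : Type*} [Fintype ι] [DecidableEq ι]
    {S : Matrix ι ι ℝ} (hS : S.PosSemidef) (f : EuclideanSpace ℝ ι → ℝ) :
    ∫ z, f (-z) ∂(multivariateGaussian 0 S) = ∫ z, f z ∂(multivariateGaussian 0 S) := by
  have hmap : (multivariateGaussian 0 S).map (fun z => -z) = multivariateGaussian 0 S := by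
    simpa [Matrix.neg_mulVec] using map_mulVec_multivariateGaussian hS (-1 : Matrix ι ι ℝ)
  conv_rhs => rw [← hmap]
  exact ((Homeomorph.neg _).measurableEmbedding.integral_map _).symm

theorem memLp_eval_multivariateGaussian {ι : Type*} [Fintype ι] [DecidableEq ι]
    (S : Matrix ι ι ℝ) (i : ι) :
    MemLp (fun z : EuclideanSpace ℝ ι => z i) 2 (multivariateGaussian 0 S) :=
  memLp_comp_eval_multivariateGaussian measurable_id (fun _ => le_rfl) 0 S i

theorem integrable_mul_eval_multivariateGaussian {ι : Type*} [Fintype ι] [DecidableEq ι]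
    (S : Matrix ι ι ℝ) (i j : ι) :
    Integrable (fun z => z i * z j) (multivariateGaussian 0 S) :=
  (memLp_eval_multivariateGaussian S i).integrable_mul (memLp_eval_multivariateGaussian S j)

theorem integral_mul_eval_multivariateGaussian {ι : Type*} [Fintype ι] [DecidableEq ι]
    {S : Matrix ι ι ℝ} (hS : S.PosSemidef) (i j : ι) :
    ∫ z, z i * z j ∂(multivariateGaussian 0 S) = S i j := by
  have hmean (k : ι) : ∫ z, z k ∂(multivariateGaussian 0 S) = 0 := by
    have hneg := integral_comp_neg_multivariateGaussian hS fun z => z k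
    simp only [PiLp.neg_apply, integral_neg] at hneg
    linarith
  rw [← covariance_eval_multivariateGaussian (μ := 0) hS,
    covariance_eq_sub (memLp_eval_multivariateGaussian S i) (memLp_eval_multivariateGaussian S j)]
  simp [hmean]

theorem integral_comp_sqrt_mul_gaussianReal {f : ℝ → ℝ} (hf : Measurable f) (v : ℝ≥0) :
    ∫ x, f (√v * x) ∂(gaussianReal 0 1) = ∫ x, f x ∂(gaussianReal 0 v) := by
  have hmap : (gaussianReal 0 1).map (√v * ·) = gaussianReal 0 v := by
    rw [gaussianReal_map_const_mul, mul_zero, mul_one]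
    congr 1
    ext
    simp
  rw [← hmap, integral_map (by fun_prop) hf.aestronglyMeasurable]

theorem integral_comp_neg_gaussianReal (v : ℝ≥0) (f : ℝ → ℝ) :
    ∫ x, f (-x) ∂(gaussianReal 0 v) = ∫ x, f x ∂(gaussianReal 0 v) := by
  conv_rhs => rw [← neg_zero, ← gaussianReal_map_neg]
  exact ((Homeomorph.neg ℝ).measurableEmbedding.integral_map f).symm

theorem measureReal_Ioi_zero_gaussianReal {v : ℝ≥0} (hv : v ≠ 0) :
    (gaussianReal 0 v).real (Set.Ioi 0) = 1 / 2 := by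
  have := nullSingletonClass_gaussianReal (μ := 0) hv
  have hneg : (gaussianReal 0 v).real (Set.Iic 0) = (gaussianReal 0 v).real (Set.Ioi 0) := by
    conv_lhs => rw [← neg_zero (G := ℝ), ← gaussianReal_map_neg]
    rw [map_measureReal_apply measurable_neg measurableSet_Iic, neg_zero,
      measureReal_congr Ioi_ae_eq_Ici]
    congr 1
    ext
    simp
  have hcompl := probReal_compl_eq_one_sub (μ := gaussianReal 0 v) (measurableSet_Ioi (a := 0))
  rw [Set.compl_Ioi, hneg] at hcompl
  linarith

theorem measureReal_Ioc_zero_gaussianReal_le {v : ℝ≥0} (hv : v ≠ 0) {t : ℝ} (ht : 0 ≤ t) :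
    (gaussianReal 0 v).real (Set.Ioc 0 t) ≤ t / √v := by
  have hpdf (x : ℝ) : gaussianPDFReal 0 v x ≤ (√v)⁻¹ := by
    have hsqrt : 0 < √(v : ℝ) := by positivity
    refine (mul_le_of_le_one_right (by positivity) (Real.exp_le_one_iff.2 ?_)).trans ?_
    · exact div_nonpos_of_nonpos_of_nonneg (neg_nonpos.2 (sq_nonneg _)) (by positivity)
    · refine inv_anti₀ hsqrt (Real.sqrt_le_sqrt ?_)
      nlinarith [Real.pi_gt_three, v.2]
  rw [measureReal_def, gaussianReal_apply_eq_integral 0 hv,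
    ENNReal.toReal_ofReal (integral_nonneg (gaussianPDFReal_nonneg 0 v))]
  calc ∫ x in Set.Ioc 0 t, gaussianPDFReal 0 v x ≤ ∫ _ in Set.Ioc 0 t, (√v)⁻¹ :=
        integral_mono (integrable_gaussianPDFReal 0 v).integrableOn (integrable_const _) hpdf
    _ = t / √v := by simp [ht, div_eq_mul_inv]

end GaussianMoments

section Relu

open scoped NNReal

variable {a b d : ℝ}

theorem measurable_relu : Measurable relu := by unfold relu; fun_prop

theorem relu_nonneg (x : ℝ) : 0 ≤ relu x := le_max_left _ _

theorem abs_relu_le (x : ℝ) : |relu x| ≤ |x| := by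
  rw [abs_of_nonneg (relu_nonneg x)]
  exact max_le (abs_nonneg x) (le_abs_self x)

theorem mul_le_relu_mul_relu_add (x y : ℝ) :
    x * y ≤ relu x * relu y + relu (-x) * relu (-y) := by
  unfold relu
  rcases le_total 0 x with hx | hx <;> rcases le_total 0 y with hy | hy <;>
    simp only [hx, hy, max_eq_right, max_eq_left, Left.neg_nonpos_iff, Left.nonneg_neg_iff] <;>
    nlinarith

theorem relu_mul_relu_add_le (x y : ℝ) :
    relu x * relu y + relu (-x) * relu (-y) ≤ (x ^ 2 + y ^ 2) / 2 := by
  unfold relu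
  rcases le_total 0 x with hx | hx <;> rcases le_total 0 y with hy | hy <;>
    simp only [hx, hy, max_eq_right, max_eq_left, Left.neg_nonpos_iff, Left.nonneg_neg_iff] <;>
    nlinarith [sq_nonneg (x - y)]

theorem relu_sq_add_relu_neg_sq (x : ℝ) : relu x ^ 2 + relu (-x) ^ 2 = x ^ 2 := by
  unfold relu
  rcases le_total 0 x with hx | hx <;> simp [hx]

theorem deriv_relu : deriv relu = (Set.Ioi 0).indicator 1 := by
  ext x
  rcases lt_trichotomy x 0 with hx | rfl | hx
  · have hzero : relu =ᶠ[nhds x] fun _ => 0 := by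
      filter_upwards [gt_mem_nhds hx] with y hy using max_eq_left hy.le
    rw [hzero.deriv_eq, deriv_const, Set.indicator_of_notMem (by exact hx.not_gt)]
  · rw [Set.indicator_of_notMem Set.self_notMem_Ioi]
    refine deriv_zero_of_not_differentiableAt fun hd => not_differentiableAt_abs_zero ?_
    have habs : (abs : ℝ → ℝ) = fun x => 2 * relu x - x := by
      ext x
      rcases le_total 0 x with h | h
      · simp only [relu, abs_of_nonneg h, max_eq_right h]; ring
      · simp only [relu, abs_of_nonpos h, max_eq_left h]; ring
    rw [habs]
    exact (hd.const_mul 2).sub differentiableAt_id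
  · have hid : relu =ᶠ[nhds x] id := by
      filter_upwards [lt_mem_nhds hx] with y hy using max_eq_right hy.le
    rw [hid.deriv_eq, deriv_id, Set.indicator_of_mem (by exact hx), Pi.one_apply]

theorem pairExp_relu_nonneg (a b d : ℝ) : 0 ≤ pairExp relu a b d :=
  integral_nonneg fun _ => mul_nonneg (relu_nonneg _) (relu_nonneg _)

theorem integrable_relu_mul_relu {ι : Type*} [Fintype ι] [DecidableEq ι] (S : Matrix ι ι ℝ)
    (i j : ι) : Integrable (fun z => relu (z i) * relu (z j)) (multivariateGaussian 0 S) :=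
  (memLp_comp_eval_multivariateGaussian measurable_relu abs_relu_le 0 S i).integrable_mul
    (memLp_comp_eval_multivariateGaussian measurable_relu abs_relu_le 0 S j)

theorem integrable_relu_neg_mul_relu_neg {ι : Type*} [Fintype ι] [DecidableEq ι]
    (S : Matrix ι ι ℝ) (i j : ι) :
    Integrable (fun z => relu (-z i) * relu (-z j)) (multivariateGaussian 0 S) := by
  have hLp := memLp_comp_eval_multivariateGaussian (measurable_relu.comp measurable_neg)
    (fun x => (abs_relu_le (-x)).trans_eq (abs_neg x)) 0 S
  exact (hLp i).integrable_mul (hLp j)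

theorem two_mul_pairExp_relu (hS : !![a, b; b, d].PosSemidef) :
    2 * pairExp relu a b d = ∫ z, (relu (z 0) * relu (z 1) + relu (-z 0) * relu (-z 1))
      ∂(multivariateGaussian (0 : EuclideanSpace ℝ (Fin 2)) !![a, b; b, d]) := by
  have hneg := integral_comp_neg_multivariateGaussian hS fun z => relu (z 0) * relu (z 1)
  simp only [PiLp.neg_apply] at hneg
  rw [integral_add (integrable_relu_mul_relu _ 0 1) (integrable_relu_neg_mul_relu_neg _ 0 1),
    hneg, two_mul, pairExp]

theorem le_two_mul_pairExp_relu (hS : !![a, b; b, d].PosSemidef) :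
    b ≤ 2 * pairExp relu a b d := by
  rw [two_mul_pairExp_relu hS]
  calc b = ∫ z, z 0 * z 1 ∂(multivariateGaussian 0 !![a, b; b, d]) :=
        (integral_mul_eval_multivariateGaussian hS 0 1).symm
    _ ≤ _ := integral_mono (integrable_mul_eval_multivariateGaussian _ 0 1)
      ((integrable_relu_mul_relu _ 0 1).add (integrable_relu_neg_mul_relu_neg _ 0 1))
      fun _ => mul_le_relu_mul_relu_add _ _

theorem two_mul_pairExp_relu_le (hS : !![a, b; b, d].PosSemidef) :
    2 * pairExp relu a b d ≤ (a + d) / 2 := by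
  have hsq (i : Fin 2) := integrable_mul_eval_multivariateGaussian !![a, b; b, d] i i
  rw [two_mul_pairExp_relu hS]
  calc _ ≤ ∫ z, (z 0 * z 0 + z 1 * z 1) / 2 ∂(multivariateGaussian 0 !![a, b; b, d]) :=
        integral_mono
          ((integrable_relu_mul_relu _ 0 1).add (integrable_relu_neg_mul_relu_neg _ 0 1))
          (((hsq 0).add (hsq 1)).div_const 2) fun z => by
            rw [← sq, ← sq]
            exact relu_mul_relu_add_le (z 0) (z 1)
    _ = (a + d) / 2 := by
      rw [integral_div, integral_add (hsq 0) (hsq 1)]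
      simp [integral_mul_eval_multivariateGaussian hS]

theorem integral_relu_sq_gaussianReal (v : ℝ≥0) :
    ∫ x, relu x ^ 2 ∂(gaussianReal 0 v) = v / 2 := by
  have hid : MemLp id 2 (gaussianReal 0 v) := memLp_id_gaussianReal 2
  have hint : Integrable (fun x => relu x ^ 2) (gaussianReal 0 v) :=
    (hid.mono measurable_relu.aestronglyMeasurable (ae_of_all _ abs_relu_le)).integrable_sq
  have hint' : Integrable (fun x => relu (-x) ^ 2) (gaussianReal 0 v) :=
    (hid.mono (measurable_relu.comp measurable_neg).aestronglyMeasurable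
      (ae_of_all _ fun x => (abs_relu_le (-x)).trans_eq (abs_neg x))).integrable_sq
  have hvar : ∫ x, x ^ 2 ∂(gaussianReal 0 v) = v := by
    rw [← variance_fun_id_gaussianReal (μ := 0), variance_eq_integral (by fun_prop)]
    simp
  have hsum := integral_add hint hint'
  simp_rw [relu_sq_add_relu_neg_sq] at hsum
  rw [hvar, integral_comp_neg_gaussianReal v fun x => relu x ^ 2] at hsum
  linarith

theorem integral_deriv_relu_sq_gaussianReal {v : ℝ≥0} (hv : v ≠ 0) :
    ∫ x, deriv relu x ^ 2 ∂(gaussianReal 0 v) = 1 / 2 := by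
  have hsq : (fun x => deriv relu x ^ 2) = (Set.Ioi 0).indicator 1 := by
    ext x
    by_cases hx : 0 < x <;> simp [deriv_relu, Set.indicator, hx]
  rw [hsq, integral_indicator_one measurableSet_Ioi, measureReal_Ioi_zero_gaussianReal hv]

theorem edgeOfChaos_relu {σw σb : ℝ} (h : EdgeOfChaos relu σw σb) : σw ^ 2 = 2 ∧ σb = 0 := by
  obtain ⟨q, hq, hvar, hchi⟩ := h
  lift q to ℝ≥0 using hq.le
  rw [integral_comp_sqrt_mul_gaussianReal (f := fun x => relu x ^ 2)
    (measurable_relu.pow_const 2), integral_relu_sq_gaussianReal] at hvar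
  rw [integral_comp_sqrt_mul_gaussianReal (f := fun x => deriv relu x ^ 2)
    ((measurable_deriv relu).pow_const 2),
    integral_deriv_relu_sq_gaussianReal (NNReal.coe_pos.1 hq).ne'] at hchi
  have hw : σw ^ 2 = 2 := by linarith
  rw [hw] at hvar
  exact ⟨hw, pow_eq_zero_iff two_ne_zero |>.1 (by linarith)⟩

theorem pairExp_deriv_relu (a b d : ℝ) :
    pairExp (deriv relu) a b d =
      (multivariateGaussian (0 : EuclideanSpace ℝ (Fin 2)) !![a, b; b, d]).real
        {z | 0 < z 0 ∧ 0 < z 1} := by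
  have hmeas : MeasurableSet {z : EuclideanSpace ℝ (Fin 2) | 0 < z 0 ∧ 0 < z 1} := by
    have hpos (i : Fin 2) : MeasurableSet {z : EuclideanSpace ℝ (Fin 2) | 0 < z i} :=
      measurableSet_lt measurable_const (by fun_prop)
    exact (hpos 0).inter (hpos 1)
  rw [← integral_indicator_one hmeas, pairExp, deriv_relu]
  congr 1 with z
  by_cases h₀ : 0 < z 0 <;> by_cases h₁ : 0 < z 1 <;> simp [Set.indicator, h₀, h₁]

theorem measureReal_abs_sub_ge_le {ι : Type*} [Fintype ι] [DecidableEq ι] {S : Matrix ι ι ℝ}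
    (hS : S.PosSemidef) (i j : ι) {t : ℝ} (ht : 0 < t) :
    (multivariateGaussian 0 S).real {z | t ≤ |z i - z j|} ≤
      (S i i + S j j - 2 * S i j) / t ^ 2 := by
  have hint : Integrable (fun z => z i * z i + z j * z j) (multivariateGaussian 0 S) :=
    (integrable_mul_eval_multivariateGaussian S i i).add
      (integrable_mul_eval_multivariateGaussian S j j)
  have hint' := (integrable_mul_eval_multivariateGaussian S i j).const_mul 2
  have hexpand (z : EuclideanSpace ℝ ι) :
      (z i - z j) ^ 2 = z i * z i + z j * z j - 2 * (z i * z j) := by ring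
  have hvar : ∫ z, (z i - z j) ^ 2 ∂(multivariateGaussian 0 S) = S i i + S j j - 2 * S i j := by
    simp_rw [hexpand]
    rw [integral_sub hint hint', integral_add (integrable_mul_eval_multivariateGaussian S i i)
      (integrable_mul_eval_multivariateGaussian S j j), integral_const_mul]
    simp only [integral_mul_eval_multivariateGaussian hS]
  have hmarkov := mul_meas_ge_le_integral_of_nonneg (μ := multivariateGaussian 0 S)
    (ae_of_all _ fun z => sq_nonneg (z i - z j))
    ((hint.sub hint').congr (ae_of_all _ fun z => (hexpand z).symm)) (t ^ 2)
  rw [le_div_iff₀' (by positivity), ← hvar]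
  simpa only [sq_le_sq, abs_of_pos ht] using hmarkov

/- If `0 < z₀` but `z₁ ≤ 0`, then either `z₀ ≤ t`, which is unlikely since the density of `z₀` is
bounded, or `|z₀ - z₁| ≥ t`, which is unlikely by Chebyshev's inequality. -/
theorem abs_two_mul_pairExp_deriv_relu_sub_one_le {t : ℝ} (ha : 0 < a)
    (hS : !![a, b; b, d].PosSemidef) (ht : 0 < t) :
    |2 * pairExp (deriv relu) a b d - 1| ≤ 2 * (t / √a) + 2 * ((a + d - 2 * b) / t ^ 2) := by
  set μ := multivariateGaussian (0 : EuclideanSpace ℝ (Fin 2)) !![a, b; b, d] with hμ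
  have hv : a.toNNReal ≠ 0 := (Real.toNNReal_pos.2 ha).ne'
  have hlaw (s : Set ℝ) (hs : MeasurableSet s) :
      μ.real {z | z 0 ∈ s} = (gaussianReal 0 a.toNNReal).real s :=
    (measurePreserving_eval_multivariateGaussian hS (i := 0)).measureReal_preimage
      hs.nullMeasurableSet
  have hpos : μ.real {z | 0 < z 0} = 1 / 2 :=
    (hlaw _ measurableSet_Ioi).trans (measureReal_Ioi_zero_gaussianReal hv)
  have hband : μ.real {z | z 0 ∈ Set.Ioc 0 t} ≤ t / √a := by
    simpa only [Real.coe_toNNReal _ ha.le] using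
      (hlaw _ measurableSet_Ioc).trans_le (measureReal_Ioc_zero_gaussianReal_le hv ht.le)
  have hfar : μ.real {z | t ≤ |z 0 - z 1|} ≤ (a + d - 2 * b) / t ^ 2 :=
    measureReal_abs_sub_ge_le hS 0 1 ht
  have hle : μ.real {z | 0 < z 0 ∧ 0 < z 1} ≤ μ.real {z | 0 < z 0} :=
    measureReal_mono fun _ hz => hz.1
  have hcover : {z : EuclideanSpace ℝ (Fin 2) | 0 < z 0} ⊆
      {z | 0 < z 0 ∧ 0 < z 1} ∪ ({z | z 0 ∈ Set.Ioc 0 t} ∪ {z | t ≤ |z 0 - z 1|}) := by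
    rintro z (h₀ : 0 < z 0)
    rcases lt_or_ge 0 (z 1) with h₁ | h₁
    · exact .inl ⟨h₀, h₁⟩
    rcases le_or_gt (z 0) t with hzt | hzt
    · exact .inr (.inl ⟨h₀, hzt⟩)
    · exact .inr (.inr ((by linarith : t ≤ z 0 - z 1).trans (le_abs_self _)))
  have hge : μ.real {z | 0 < z 0} ≤ μ.real {z | 0 < z 0 ∧ 0 < z 1} +
      (μ.real {z | z 0 ∈ Set.Ioc 0 t} + μ.real {z | t ≤ |z 0 - z 1|}) :=
    (measureReal_mono hcover).trans ((measureReal_union_le _ _).trans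
      (add_le_add_right (measureReal_union_le _ _) _))
  have hstrip : 0 ≤ t / √a := by positivity
  rw [pairExp_deriv_relu, ← hμ, abs_le]
  constructor <;> linarith [hstrip, measureReal_nonneg.trans hfar]

end Relu

section Superharmonic

open Filter Matrix Topology

variable {ι : Type*} [Fintype ι] [DecidableEq ι] {A : Matrix ι ι ℝ} {x : ℕ → ι → ℝ}

theorem pow_mulVec_le_of_mem_rowStochastic (hA : A ∈ rowStochastic ℝ ι)
    (h : ∀ l i, (A *ᵥ x l) i ≤ x (l + 1) i) (k l : ℕ) (i : ι) :
    ((A ^ k) *ᵥ x l) i ≤ x (l + k) i := by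
  have hneg := le_pow_mulVec_add_of_mem_rowStochastic hA (x := fun l => -x l) (ε := 0)
    (fun l i => by simpa [mulVec_neg] using h l i) k l i
  simpa [mulVec_neg] using hneg

theorem exists_pos_forall_eventually_le_of_superharmonic (hA : A ∈ rowStochastic ℝ ι)
    (hprim : A.IsPrimitive) (h : ∀ l i, (A *ᵥ x l) i ≤ x (l + 1) i) (hx : ∀ i, 0 ≤ x 0 i) {j : ι}
    (hj : 0 < x 0 j) : ∃ m > 0, ∀ i, ∀ᶠ l in atTop, m ≤ x l i := by
  obtain ⟨k, -, δ, hδ₀, hδ⟩ := exists_forall_le_pow_of_isPrimitive hprim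
  have hk (i : ι) : δ * x 0 j ≤ x k i :=
    calc δ * x 0 j ≤ (A ^ k) i j * x 0 j := mul_le_mul_of_nonneg_right (hδ i j) hj.le
      _ ≤ ((A ^ k) *ᵥ x 0) i := Finset.single_le_sum (f := fun j => (A ^ k) i j * x 0 j)
        (fun j _ => mul_nonneg ((pow_mem hA k).1 i j) (hx j)) (Finset.mem_univ j)
      _ ≤ x k i := by simpa only [zero_add] using pow_mulVec_le_of_mem_rowStochastic hA h k 0 i
  refine ⟨δ * x 0 j, mul_pos hδ₀ hj, fun i => eventually_atTop.2 ⟨k, fun l hl => ?_⟩⟩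
  obtain ⟨m, rfl⟩ := Nat.exists_eq_add_of_le hl
  exact (le_mulVec_of_mem_rowStochastic (pow_mem hA m) hk i).trans
    (pow_mulVec_le_of_mem_rowStochastic hA h m k i)

end Superharmonic

section ReluKernel

open Asymptotics Filter Topology

theorem expDecay_two_mul_pairExp_deriv_relu_sub_one {a b d : ℕ → ℝ} {c : ℝ} (hc : 0 < c)
    (hS : ∀ l, !![a l, b l; b l, d l].PosSemidef) (ha : ExpDecay fun l => a l - c)
    (hb : ExpDecay fun l => b l - c) (hd : ExpDecay fun l => d l - c) :
    ExpDecay fun l => 2 * pairExp (deriv relu) (a l) (b l) (d l) - 1 := by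
  obtain ⟨γ, hγ, K, -, hK⟩ :=
    ((ha.norm.add hb.norm).add (hb.norm.add hd.norm)).exists_forall_norm_le
  -- The bound for `P(z₀ > 0, z₁ > 0)` balances when the threshold `t` is a cube root of the error.
  obtain ⟨q, ⟨hq₀, hq₁⟩, rfl⟩ : ∃ q ∈ Set.Ioo (0 : ℝ) 1, q ^ 3 = γ :=
    ⟨γ ^ (3 : ℝ)⁻¹, ⟨Real.rpow_pos_of_pos hγ.1 _, Real.rpow_lt_one hγ.1.le hγ.2 (by norm_num)⟩,
      by simpa using Real.rpow_inv_natCast_pow hγ.1.le three_ne_zero⟩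
  have ha_lim : Tendsto a atTop (𝓝 c) := by simpa using ha.tendsto_zero.add_const c
  refine ⟨q, ⟨hq₀, hq₁⟩, IsBigO.of_bound (2 / √(c / 2) + 2 * K) ?_⟩
  filter_upwards [ha_lim.eventually (lt_mem_nhds (half_lt_self hc))] with l hl
  have hql : 0 < q ^ l := pow_pos hq₀ l
  have herr : a l + d l - 2 * b l ≤ K * (q ^ l) ^ 3 := by
    have hKl := (le_abs_self _).trans (hK l)
    rw [pow_right_comm]
    simp only [Real.norm_eq_abs] at hKl
    linarith [le_abs_self (a l - c), neg_abs_le (b l - c), le_abs_self (d l - c)]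
  rw [Real.norm_eq_abs, Real.norm_of_nonneg hql.le]
  calc |2 * pairExp (deriv relu) (a l) (b l) (d l) - 1|
      ≤ 2 * (q ^ l / √(a l)) + 2 * ((a l + d l - 2 * b l) / (q ^ l) ^ 2) :=
        abs_two_mul_pairExp_deriv_relu_sub_one_le ((half_pos hc).trans hl) (hS l) hql
    _ ≤ 2 * (q ^ l / √(c / 2)) + 2 * (K * (q ^ l) ^ 3 / (q ^ l) ^ 2) := by gcongr
    _ = (2 / √(c / 2) + 2 * K) * q ^ l := by field_simp

theorem expDecay_covDotStep_relu_sub_one {V : Type*} [Fintype V] {S : ℕ → V → V → ℝ} {c σw : ℝ}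
    (hw : σw ^ 2 = 2) (hc : 0 < c) (hS : ∀ l, (Matrix.of (S l)).PosSemidef)
    (hlim : ExpDecay fun l (p : V × V) => S l p.1 p.2 - c) :
    ExpDecay fun l (p : V × V) => covDotStep relu σw (S l) p.1 p.2 - 1 := by
  refine ExpDecay.pi fun p => ?_
  simp_rw [fun l => covDotStep_eq_pairExp relu σw (symm_of_posSemidef (hS l) p.1 p.2), hw]
  exact expDecay_two_mul_pairExp_deriv_relu_sub_one hc (fun l => posSemidef_pair (hS l) p.1 p.2)
    (hlim.apply (p.1, p.1)) (hlim.apply p) (hlim.apply (p.2, p.2))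

variable {V : Type*} [Fintype V] [DecidableEq V] {G : SimpleGraph V} [DecidableRel G.Adj] {d : ℕ}
  {h : V → EuclideanSpace ℝ (Fin d)} {σw σb : ℝ} {R : ℕ}

theorem posSemidef_gpk_relu (l r : ℕ) : (Matrix.of (gpk G h relu σw σb R l r)).PosSemidef :=
  posSemidef_gpk measurable_relu abs_relu_le l r

theorem gpk_relu_succ (hw : σw ^ 2 = 2) (hb : σb = 0) (l r : ℕ) (u u' : V) :
    gpk G h relu σw σb R l (r + 1) u u' = 2 * pairExp relu (gpk G h relu σw σb R l r u u)
      (gpk G h relu σw σb R l r u u') (gpk G h relu σw σb R l r u' u') := by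
  rw [gpk_succ, covStep_eq_pairExp _ _ _ (symm_of_posSemidef (posSemidef_gpk_relu l r) u u'), hw,
    hb, sq, mul_zero, add_zero]

theorem gpk_relu_mono (hw : σw ^ 2 = 2) (hb : σb = 0) (l : ℕ) (u u' : V) :
    Monotone fun r => gpk G h relu σw σb R l r u u' :=
  monotone_nat_of_le_succ fun r => by
    rw [gpk_relu_succ hw hb]
    exact le_two_mul_pairExp_relu (posSemidef_pair (posSemidef_gpk_relu l r) u u')

theorem gpk_relu_le (hw : σw ^ 2 = 2) (hb : σb = 0) {l : ℕ} {M : ℝ}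
    (hM : ∀ u u', gpk G h relu σw σb R l 0 u u' ≤ M) (r : ℕ) (u u' : V) :
    gpk G h relu σw σb R l r u u' ≤ M := by
  induction r generalizing u u' with
  | zero => exact hM u u'
  | succ r ih =>
    have hS := posSemidef_gpk_relu (G := G) (h := h) (σw := σw) (σb := σb) (R := R) l r
    have hle := two_mul_pairExp_relu_le (posSemidef_pair hS u u')
    rw [gpk_relu_succ hw hb]
    linarith [ih u u, ih u' u']

theorem pairExp_relu_zero : pairExp relu 0 0 0 = 0 := by
  have hle := two_mul_pairExp_relu_le
    (posSemidef_pair (S := (0 : Unit → Unit → ℝ)) Matrix.PosSemidef.zero () ())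
  simp only [Pi.zero_apply] at hle
  exact (pairExp_relu_nonneg 0 0 0).antisymm' (by linarith)

theorem gpk_relu_eq_zero (hb : σb = 0) (h₀ : h = 0) (l r : ℕ) :
    gpk G h relu σw σb R l r = 0 := by
  refine gpk_induction (p := (· = 0)) ?_ ?_ ?_ l r
  · ext u u'
    simp [h₀]
  · rintro _ rfl
    ext u u'
    simp [aggregate]
  · rintro _ rfl
    ext u u'
    rw [covStep_eq_pairExp relu σw σb (S := 0) (u := u) (u' := u') rfl]
    simp [pairExp_relu_zero, hb]

theorem gntk_relu_eq_zero (hb : σb = 0) (h₀ : h = 0) (l r : ℕ) :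
    gntk G h relu σw σb R l r = 0 := by
  refine layer_induction (R := R) ?_ (fun l hl => ?_) (fun l r hr => ?_) l r <;> ext u u'
  · simp [gntk, h₀]
  · simp [gntk_succ_zero, hl, aggregate]
  · simp [gntk_succ, hr, gpk_relu_eq_zero hb h₀ l (r + 1)]

theorem exists_expDecay_gpk_relu_sub [Nonempty V] (hw : σw ^ 2 = 2) (hb : σb = 0)
    (hirr : (aggMatrix G).IsIrreducible) :
    ∃ c : ℝ, ∀ r, ExpDecay fun l (p : V × V) => gpk G h relu σw σb R l r p.1 p.2 - c := by
  have hA := aggMatrix_mem_rowStochastic G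
  set S := gpk G h relu σw σb R
  have hmono (l : ℕ) (u u' : V) : Monotone fun r => S l r u u' := gpk_relu_mono hw hb l u u'
  have hagg (l : ℕ) (p : V × V) :
      S (l + 1) 0 p.1 p.2 = (aggMatrix G *ᵥ fun q => S l R q.1 q.2) p := by
    rw [aggMatrix_mulVec, ← gpk_succ_zero]
  obtain ⟨κ, hκ⟩ : ∃ κ : ℝ, ExpDecay fun l (p : V × V) => -S l 0 p.1 p.2 - κ := by
    refine exists_expDecay_sub_of_subharmonic hA (isPrimitive_aggMatrix G hirr)
      (ExpDecay.zero (E := ℝ)) (fun l p => ?_) fun l p => ?_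
    · have hle := mulVec_mono_of_mem_rowStochastic hA
        (fun q : V × V => neg_le_neg (hmono l q.1 q.2 (Nat.zero_le R))) p
      have hneg : (aggMatrix G *ᵥ fun q => -S l R q.1 q.2) p = -S (l + 1) 0 p.1 p.2 := by
        rw [hagg, ← Pi.neg_apply, ← Matrix.mulVec_neg]; rfl
      linarith
    · have hmax (u u' : V) : S l 0 u u' ≤ -⨅ q : V × V, -S l 0 q.1 q.2 :=
        le_neg.2 (ciInf_le (Finite.bddBelow_range _) (u, u'))
      have hle := mulVec_le_of_mem_rowStochastic hA (fun q => gpk_relu_le hw hb hmax R q.1 q.2) p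
      rw [hagg]
      linarith
  refine ⟨-κ, fun r => hκ.of_norm_le 1 fun l => ?_⟩
  set e := ‖fun p : V × V => -S l 0 p.1 p.2 - κ‖
  have hzero (u u' : V) : |-S l 0 u u' - κ| ≤ e :=
    norm_le_pi_norm (fun p : V × V => -S l 0 p.1 p.2 - κ) (u, u')
  have hupper (u u' : V) : S l r u u' ≤ e - κ :=
    gpk_relu_le hw hb (fun u u' => by linarith [(abs_le.1 (hzero u u')).1]) r u u'
  refine (pi_norm_le_iff_of_nonneg (by positivity)).2 fun p => abs_le.2 ⟨?_, ?_⟩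
  · linarith [hmono l p.1 p.2 (Nat.zero_le r), (abs_le.1 (hzero p.1 p.2)).2]
  · linarith [hupper p.1 p.2]

theorem gpk_relu_limit_pos [Nonempty V] (hw : σw ^ 2 = 2) (hb : σb = 0)
    (hirr : (aggMatrix G).IsIrreducible) (hR : 0 < R) (h₀ : h ≠ 0) {c : ℝ}
    (hlim : ExpDecay fun l (p : V × V) => gpk G h relu σw σb R l R p.1 p.2 - c) : 0 < c := by
  set S := gpk G h relu σw σb R
  have hmono (l : ℕ) (u u' : V) : Monotone fun r => S l r u u' := gpk_relu_mono hw hb l u u'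
  obtain ⟨u₀, hu₀⟩ := Function.ne_iff.1 h₀
  have hpos : 0 < S 0 R u₀ u₀ :=
    calc 0 < S 0 0 u₀ u₀ := by simpa only [S, gpk_zero_zero] using real_inner_self_pos.2 hu₀
      _ ≤ S 0 R u₀ u₀ := hmono 0 u₀ u₀ (Nat.zero_le R)
  have hnonneg (p : V × V) : 0 ≤ S 0 R p.1 p.2 := by
    obtain ⟨r, rfl⟩ := Nat.exists_eq_add_of_lt hR
    simp only [S]
    rw [gpk_relu_succ hw hb]
    exact mul_nonneg zero_le_two (pairExp_relu_nonneg _ _ _)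
  have hsup (l : ℕ) (p : V × V) :
      (aggMatrix G *ᵥ fun q => S l R q.1 q.2) p ≤ S (l + 1) R p.1 p.2 := by
    rw [aggMatrix_mulVec, ← gpk_succ_zero]
    exact hmono (l + 1) p.1 p.2 (Nat.zero_le R)
  obtain ⟨m, hm, hle⟩ := exists_pos_forall_eventually_le_of_superharmonic
    (aggMatrix_mem_rowStochastic G) (isPrimitive_aggMatrix G hirr)
    (x := fun l p => S l R p.1 p.2) (j := (u₀, u₀)) hsup hnonneg hpos
  have htendsto := (hlim.apply (u₀, u₀)).tendsto_zero.add_const c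
  simp only [sub_add_cancel, zero_add] at htendsto
  exact hm.trans_le (ge_of_tendsto htendsto (hle (u₀, u₀)))

theorem exists_linear_growth_gntk_relu [Nonempty V] (hw : σw ^ 2 = 2) (hb : σb = 0)
    (hirr : (aggMatrix G).IsIrreducible) :
    ∃ c κ : ℝ, ∀ r ≤ R, ExpDecay fun l (p : V × V) =>
      gntk G h relu σw σb R l r p.1 p.2 - (R * l * c + (κ + r * c)) := by
  by_cases h₀ : h = 0
  · refine ⟨0, 0, fun r _ => ExpDecay.pi fun p => ?_⟩
    simpa [gntk_relu_eq_zero hb h₀] using ExpDecay.zero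
  obtain ⟨c, hc⟩ := exists_expDecay_gpk_relu_sub (h := h) (R := R) hw hb hirr
  refine ⟨c, exists_linear_growth_gntk hirr (fun r hr => ?_) fun r _ => hc (r + 1)⟩
  exact expDecay_covDotStep_relu_sub_one hw (gpk_relu_limit_pos hw hb hirr (by omega) h₀ (hc R))
    (fun l => posSemidef_gpk_relu l r) (hc r)

end ReluKernel

section Tanh

open Real (tanh sinh cosh)

/-- The derivative `1 - tanh² = 1 / cosh²` of the hyperbolic tangent. -/
noncomputable def sechSq (x : ℝ) : ℝ := 1 - tanh x ^ 2

theorem hasDerivAt_tanh (x : ℝ) : HasDerivAt tanh (sechSq x) x := by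
  have htanh : tanh = fun x => sinh x / cosh x := funext Real.tanh_eq_sinh_div_cosh
  have hcosh := (Real.cosh_pos x).ne'
  rw [htanh]
  refine ((Real.hasDerivAt_sinh x).div (Real.hasDerivAt_cosh x) hcosh).congr_deriv ?_
  rw [sechSq, Real.tanh_eq_sinh_div_cosh]
  field_simp

theorem deriv_tanh : deriv tanh = sechSq := funext fun x => (hasDerivAt_tanh x).deriv

@[fun_prop]
theorem continuous_tanh : Continuous tanh :=
  continuous_iff_continuousAt.2 fun x => (hasDerivAt_tanh x).continuousAt

@[fun_prop]
theorem continuous_sechSq : Continuous sechSq := by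
  unfold sechSq
  fun_prop

theorem abs_tanh_le_one (x : ℝ) : |tanh x| ≤ 1 := (Real.abs_tanh_lt_one x).le

theorem sechSq_pos (x : ℝ) : 0 < sechSq x := sub_pos.2 (Real.tanh_sq_lt_one x)

theorem abs_sechSq_le_one (x : ℝ) : |sechSq x| ≤ 1 := by
  rw [abs_of_pos (sechSq_pos x)]
  exact sub_le_self 1 (sq_nonneg _)

theorem tanh_strictMono : StrictMono tanh :=
  strictMono_of_deriv_pos fun x => by rw [deriv_tanh]; exact sechSq_pos x

theorem tanh_nonneg {x : ℝ} (hx : 0 ≤ x) : 0 ≤ tanh x := by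
  simpa using tanh_strictMono.monotone hx

theorem abs_tanh (x : ℝ) : |tanh x| = tanh |x| := by
  rcases le_total 0 x with hx | hx
  · rw [abs_of_nonneg hx, abs_of_nonneg (tanh_nonneg hx)]
  · rw [abs_of_nonpos hx, Real.tanh_neg, abs_of_nonpos]
    simpa using tanh_strictMono.monotone hx

theorem lipschitzWith_tanh : LipschitzWith 1 tanh :=
  lipschitzWith_of_nnnorm_deriv_le (fun x => (hasDerivAt_tanh x).differentiableAt) fun x => by
    rw [deriv_tanh, ← NNReal.coe_le_coe]
    exact abs_sechSq_le_one x

theorem abs_tanh_sub_tanh_le (x y : ℝ) : |tanh x - tanh y| ≤ |x - y| := by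
  simpa [Real.dist_eq] using lipschitzWith_tanh.dist_le_mul x y

theorem abs_tanh_le_abs (x : ℝ) : |tanh x| ≤ |x| := by
  simpa using abs_tanh_sub_tanh_le x 0

theorem abs_sechSq_sub_le (x y : ℝ) : |sechSq x - sechSq y| ≤ 2 * |x - y| := by
  have hfactor : sechSq x - sechSq y = -((tanh x + tanh y) * (tanh x - tanh y)) := by
    unfold sechSq; ring
  rw [hfactor, abs_neg, abs_mul]
  have hsum : |tanh x + tanh y| ≤ 2 :=
    (abs_add_le _ _).trans (by linarith [abs_tanh_le_one x, abs_tanh_le_one y])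
  exact mul_le_mul hsum (abs_tanh_sub_tanh_le x y) (abs_nonneg _) zero_le_two

theorem tanh_sq_le_of_abs_le {x y : ℝ} (h : |x| ≤ |y|) : tanh x ^ 2 ≤ tanh y ^ 2 := by
  rw [sq_le_sq, abs_tanh, abs_tanh]
  exact tanh_strictMono.monotone h

theorem tanh_mul_le {c x : ℝ} (hc : 1 ≤ c) (hx : 0 ≤ x) : tanh (c * x) ≤ c * tanh x := by
  have hderiv (t : ℝ) : HasDerivAt (fun t => c * tanh t - tanh (c * t))
      (c * sechSq t - sechSq (c * t) * c) t :=
    ((hasDerivAt_tanh t).const_mul c).sub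
      ((hasDerivAt_tanh (c * t)).comp t (hasDerivAt_const_mul c))
  have hmono : Monotone fun t => c * tanh t - tanh (c * t) := by
    refine monotone_of_deriv_nonneg (fun t => (hderiv t).differentiableAt) fun t => ?_
    have hsq : tanh t ^ 2 ≤ tanh (c * t) ^ 2 := by
      refine tanh_sq_le_of_abs_le ?_
      rw [abs_mul, abs_of_nonneg (zero_le_one.trans hc)]
      exact le_mul_of_one_le_left (abs_nonneg t) hc
    rw [(hderiv t).deriv, sechSq, sechSq]
    nlinarith
  simpa using hmono hx

theorem tanh_mul_sq_le {c : ℝ} (hc : 1 ≤ c) (x : ℝ) :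
    tanh (c * x) ^ 2 ≤ c ^ 2 * tanh x ^ 2 := by
  have hc₀ : |c| = c := abs_of_nonneg (zero_le_one.trans hc)
  rw [← mul_pow, sq_le_sq, abs_mul, abs_tanh, abs_tanh, abs_mul, hc₀]
  exact tanh_mul_le hc (abs_nonneg x)

theorem tanh_add_tanh_sub (x y : ℝ) :
    tanh (x + y) + tanh (x - y) = 2 * sinh (2 * x) / (cosh (2 * x) + cosh (2 * y)) := by
  have hadd := (Real.cosh_pos (x + y)).ne'
  have hsub := (Real.cosh_pos (x - y)).ne'
  have hcosh : cosh (2 * x) + cosh (2 * y) = 2 * (cosh (x + y) * cosh (x - y)) := by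
    rw [show 2 * x = (x + y) + (x - y) by ring, show 2 * y = (x + y) - (x - y) by ring,
      Real.cosh_add (x + y), Real.cosh_sub (x + y)]
    ring
  have hsinh : sinh (2 * x) = sinh (x + y) * cosh (x - y) + cosh (x + y) * sinh (x - y) := by
    rw [← Real.sinh_add]
    ring_nf
  rw [Real.tanh_eq_sinh_div_cosh, Real.tanh_eq_sinh_div_cosh, hcosh, hsinh]
  field_simp

theorem tanh_mul_sinh_nonneg {x y : ℝ} (h : 0 ≤ x * y) : 0 ≤ tanh x * sinh y := by
  have hpos {x y : ℝ} (hx : 0 ≤ x) (hy : 0 ≤ y) : 0 ≤ tanh x * sinh y :=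
    mul_nonneg (tanh_nonneg hx) (Real.sinh_nonneg_iff.2 hy)
  rcases mul_nonneg_iff.1 h with ⟨hx, hy⟩ | ⟨hx, hy⟩
  · exact hpos hx hy
  · simpa [Real.tanh_neg, Real.sinh_neg] using hpos (neg_nonneg.2 hx) (neg_nonneg.2 hy)

end Tanh

section Poincare

theorem hasDerivAt_gaussianPDFReal (x : ℝ) :
    HasDerivAt (gaussianPDFReal 0 1) (-x * gaussianPDFReal 0 1 x) x := by
  have hpdf : gaussianPDFReal 0 1 = fun x => (√(2 * Real.pi))⁻¹ * Real.exp (-x ^ 2 / 2) := by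
    ext x
    simp [gaussianPDFReal_def]
  have hexp : HasDerivAt (fun x : ℝ => -x ^ 2 / 2) (-x) x := by
    refine ((hasDerivAt_pow 2 x).neg.div_const 2).congr_deriv ?_
    simp only [Nat.cast_ofNat, Nat.add_one_sub_one, pow_one]
    ring
  rw [hpdf]
  exact (hexp.exp.const_mul _).congr_deriv (by ring)

theorem integral_id_mul_gaussianReal {f f' : ℝ → ℝ} {C C' : ℝ}
    (hf : ∀ x, HasDerivAt f (f' x) x) (hC : ∀ x, |f x| ≤ C) (hC' : ∀ x, |f' x| ≤ C') :
    ∫ x, x * f x ∂(gaussianReal 0 1) = ∫ x, f' x ∂(gaussianReal 0 1) := by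
  have hfc : Continuous f := continuous_iff_continuousAt.2 fun x => (hf x).continuousAt
  have hf' : Measurable f' := by
    rw [show f' = deriv f from funext fun x => (hf x).deriv.symm]
    exact measurable_deriv f
  have hpdf := integrable_gaussianPDFReal 0 1
  have hid : Integrable fun x : ℝ => -x * gaussianPDFReal 0 1 x := by
    have h : Integrable (fun x : ℝ => x) (gaussianReal 0 1) := IsGaussian.integrable_id
    rw [gaussianReal_of_var_ne_zero _ one_ne_zero,
      integrable_withDensity_iff (measurable_gaussianPDF 0 1)
        (ae_of_all _ fun x => gaussianPDF_lt_top)] at h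
    simp only [toReal_gaussianPDF] at h
    simpa using h.neg
  have hparts := integral_mul_deriv_eq_deriv_mul_of_integrable
    (fun x _ => hasDerivAt_gaussianPDFReal x) (fun x _ => hf x)
    (hpdf.mul_bdd hf'.aestronglyMeasurable (ae_of_all _ hC'))
    (hid.mul_bdd hfc.aestronglyMeasurable (ae_of_all _ hC))
    (hpdf.mul_bdd hfc.aestronglyMeasurable (ae_of_all _ hC))
  rw [integral_gaussianReal_eq_integral_smul one_ne_zero,
    integral_gaussianReal_eq_integral_smul one_ne_zero]
  simp only [smul_eq_mul]
  rw [hparts, ← integral_neg]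
  congr 1 with x
  ring

theorem abs_dslope_le {f f' : ℝ → ℝ} {C : ℝ} (hf : ∀ x, HasDerivAt f (f' x) x)
    (hC : ∀ x, |f' x| ≤ C) (a x : ℝ) : |dslope f a x| ≤ C := by
  rcases eq_or_ne x a with rfl | hx
  · rw [dslope_same, (hf x).deriv]
    exact hC x
  · rw [dslope_of_ne f hx, slope_def_field, abs_div, div_le_iff₀ (abs_sub_pos.2 hx)]
    exact convex_univ.norm_image_sub_le_of_norm_hasDerivWithin_le
      (fun y _ => (hf y).hasDerivWithinAt) (fun y _ => hC y) (Set.mem_univ a) (Set.mem_univ x)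

theorem hasDerivAt_mul_dslope_zero {g g' : ℝ → ℝ} (hg : ∀ x, HasDerivAt g (g' x) x)
    (h₀ : g 0 = 0) (x : ℝ) : HasDerivAt (fun x => g x * dslope g 0 x)
      (2 * g' x * dslope g 0 x - dslope g 0 x ^ 2) x := by
  have hmul (x : ℝ) : x * dslope g 0 x = g x := by simpa [h₀] using sub_smul_dslope g 0 x
  rcases eq_or_ne x 0 with rfl | hx
  · have hcont : ContinuousAt (fun x => dslope g 0 x ^ 2) 0 :=
      (continuousAt_dslope_same.2 (hg 0).differentiableAt).pow 2
    have hsame : dslope g 0 0 = g' 0 := (dslope_same g 0).trans (hg 0).deriv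
    refine hasDerivAt_iff_tendsto_slope.2 ?_
    rw [show 2 * g' 0 * dslope g 0 0 - dslope g 0 0 ^ 2 = dslope g 0 0 ^ 2 by rw [hsame]; ring]
    refine (hcont.tendsto.mono_left nhdsWithin_le_nhds).congr' ?_
    filter_upwards [self_mem_nhdsWithin] with x hx
    rw [slope_def_field, ← hmul x, h₀, zero_mul, sub_zero, sub_zero, mul_assoc,
      mul_div_cancel_left₀ _ hx, sq]
  · have hquot : dslope g 0 =ᶠ[nhds x] fun x => g x / x := by
      filter_upwards [isOpen_ne.mem_nhds hx] with y hy
      rw [← hmul y, mul_div_cancel_left₀ _ hy]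
    have hderiv : HasDerivAt (dslope g 0) ((g' x * x - g x * 1) / x ^ 2) x :=
      ((hg x).div (hasDerivAt_id x) hx).congr_of_eventuallyEq hquot
    refine ((hg x).mul hderiv).congr_deriv ?_
    rw [hquot.eq_of_nhds]
    field

-- Stein's identity for `g x ^ 2 / x`, whose derivative `2 g' k - k ^ 2` with `k x = g x / x` is at
-- most `g' ^ 2`.
theorem integral_sq_le_integral_deriv_sq {g g' : ℝ → ℝ} {C C' : ℝ}
    (hg : ∀ x, HasDerivAt g (g' x) x) (h₀ : g 0 = 0) (hC : ∀ x, |g x| ≤ C)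
    (hC' : ∀ x, |g' x| ≤ C') :
    ∫ x, g x ^ 2 ∂(gaussianReal 0 1) ≤ ∫ x, g' x ^ 2 ∂(gaussianReal 0 1) := by
  set k := dslope g 0
  have hmul (x : ℝ) : x * k x = g x := by simpa [h₀] using sub_smul_dslope g 0 x
  have hk (x : ℝ) : |k x| ≤ C' := abs_dslope_le hg hC' 0 x
  have hgk (x : ℝ) : |g x * k x| ≤ C * C' := by
    rw [abs_mul]
    exact mul_le_mul (hC x) (hk x) (abs_nonneg _) ((abs_nonneg _).trans (hC 0))
  have hsq (x : ℝ) : g' x ^ 2 ≤ C' ^ 2 := sq_le_sq' (abs_le.1 (hC' x)).1 (abs_le.1 (hC' x)).2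
  have hle (x : ℝ) : 2 * g' x * k x - k x ^ 2 ≤ g' x ^ 2 := by linarith [sq_nonneg (g' x - k x)]
  have hge (x : ℝ) : -(3 * C' ^ 2) ≤ 2 * g' x * k x - k x ^ 2 := by
    have hksq : k x ^ 2 ≤ C' ^ 2 := sq_le_sq' (abs_le.1 (hk x)).1 (abs_le.1 (hk x)).2
    linarith [sq_nonneg (g' x + k x), hsq x]
  have hbound (x : ℝ) : |2 * g' x * k x - k x ^ 2| ≤ 3 * C' ^ 2 :=
    abs_le.2 ⟨hge x, (hle x).trans (by linarith [hsq x, sq_nonneg C'])⟩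
  have hg' : Measurable g' := by
    rw [show g' = deriv g from funext fun x => (hg x).deriv.symm]
    exact measurable_deriv g
  have hkm : Measurable fun x => 2 * g' x * k x - k x ^ 2 := by
    rw [funext fun x => (hasDerivAt_mul_dslope_zero hg h₀ x).deriv.symm]
    exact measurable_deriv _
  calc ∫ x, g x ^ 2 ∂(gaussianReal 0 1) = ∫ x, x * (g x * k x) ∂(gaussianReal 0 1) := by
        simp_rw [mul_left_comm _ (g _), hmul, sq]
    _ = ∫ x, 2 * g' x * k x - k x ^ 2 ∂(gaussianReal 0 1) :=
        integral_id_mul_gaussianReal (hasDerivAt_mul_dslope_zero hg h₀) hgk hbound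
    _ ≤ ∫ x, g' x ^ 2 ∂(gaussianReal 0 1) :=
        integral_mono (.of_bound hkm.aestronglyMeasurable _ (ae_of_all _ hbound))
          (.of_bound (hg'.pow_const 2).aestronglyMeasurable _ (ae_of_all _ fun x => by
            rw [Real.norm_of_nonneg (sq_nonneg _)]; exact hsq x)) hle

end Poincare

section BoundedPairs

variable {ψ : ℝ → ℝ} {a b d p q r s C : ℝ}

theorem integral_sq_gaussianReal : ∫ x, x ^ 2 ∂(gaussianReal 0 1) = 1 := by
  simpa [variance_eq_integral aemeasurable_id'] using
    variance_fun_id_gaussianReal (μ := 0) (v := 1)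

theorem integral_linear_sq_gaussianReal_prod (p q : ℝ) :
    ∫ w, (p * w.1 + q * w.2) ^ 2 ∂((gaussianReal 0 1).prod (gaussianReal 0 1)) =
      p ^ 2 + q ^ 2 := by
  have hself := pairExp_self measurable_id (add_nonneg (sq_nonneg p) (sq_nonneg q))
  rw [pairExp_eq_integral_prod measurable_id rfl (by ring) rfl] at hself
  simpa [mul_pow, integral_const_mul, integral_sq_gaussianReal, ← sq,
    Real.sq_sqrt (add_nonneg (sq_nonneg p) (sq_nonneg q))] using hself

theorem integrable_linear_sq_gaussianReal_prod (p q : ℝ) :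
    Integrable (fun w : ℝ × ℝ => (p * w.1 + q * w.2) ^ 2)
      ((gaussianReal 0 1).prod (gaussianReal 0 1)) := by
  have hid : MemLp (id : ℝ → ℝ) 2 (gaussianReal 0 1) := IsGaussian.memLp_two_id
  exact (((hid.comp_measurePreserving measurePreserving_fst).const_mul p).add
    ((hid.comp_measurePreserving measurePreserving_snd).const_mul q)).integrable_sq

theorem integrable_comp_mul_comp_gaussianReal_prod (hψ : Measurable ψ) (hC : ∀ x, |ψ x| ≤ C)
    (p q r s : ℝ) : Integrable
      (fun w : ℝ × ℝ => ψ (p * w.1 + q * w.2) * ψ (r * w.1 + s * w.2))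
      ((gaussianReal 0 1).prod (gaussianReal 0 1)) :=
  .of_bound (C := C * C) (by fun_prop) (ae_of_all _ fun w => by
    rw [norm_mul]
    exact mul_le_mul (hC _) (hC _) (norm_nonneg _) ((abs_nonneg _).trans (hC 0)))

theorem integrable_add_mul_sq_gaussianReal_prod (hψ : Measurable ψ) (hC : ∀ x, |ψ x| ≤ C)
    (p q r s t : ℝ) : Integrable
      (fun w : ℝ × ℝ => (ψ (p * w.1 + q * w.2) + t * ψ (r * w.1 + s * w.2)) ^ 2)
      ((gaussianReal 0 1).prod (gaussianReal 0 1)) := by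
  have hint := integrable_comp_mul_comp_gaussianReal_prod hψ hC
  refine (((hint p q p q).add ((hint p q r s).const_mul (2 * t))).add
    ((hint r s r s).const_mul (t ^ 2))).congr (ae_of_all _ fun w => ?_)
  simp only [Pi.add_apply]
  ring

theorem integral_add_mul_sq_eq_pairExp (hψ : Measurable ψ) (hC : ∀ x, |ψ x| ≤ C)
    (ha : a = p ^ 2 + q ^ 2) (hb : b = p * r + q * s) (hd : d = r ^ 2 + s ^ 2) (t : ℝ) :
    ∫ w, (ψ (p * w.1 + q * w.2) + t * ψ (r * w.1 + s * w.2)) ^ 2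
        ∂((gaussianReal 0 1).prod (gaussianReal 0 1)) =
      pairExp ψ a a a + 2 * t * pairExp ψ a b d + t ^ 2 * pairExp ψ d d d := by
  have hint := integrable_comp_mul_comp_gaussianReal_prod hψ hC
  have hexpand (x y : ℝ) : (x + t * y) ^ 2 = x * x + (2 * t * (x * y) + t ^ 2 * (y * y)) := by
    ring
  simp_rw [hexpand]
  rw [integral_add (hint p q p q),
    integral_add ((hint p q r s).const_mul (2 * t)) ((hint r s r s).const_mul (t ^ 2)),
    integral_const_mul, integral_const_mul, ← pairExp_eq_integral_prod hψ ha hb hd,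
    ← pairExp_eq_integral_prod hψ ha (ha.trans (by ring)) ha,
    ← pairExp_eq_integral_prod hψ hd (hd.trans (by ring)) hd, add_assoc]
  exact ((hint p q r s).const_mul (2 * t)).add ((hint r s r s).const_mul (t ^ 2))

theorem integral_sub_sq_eq_pairExp (hψ : Measurable ψ) (hC : ∀ x, |ψ x| ≤ C)
    (ha : a = p ^ 2 + q ^ 2) (hb : b = p * r + q * s) (hd : d = r ^ 2 + s ^ 2) :
    ∫ w, (ψ (p * w.1 + q * w.2) - ψ (r * w.1 + s * w.2)) ^ 2
        ∂((gaussianReal 0 1).prod (gaussianReal 0 1)) =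
      pairExp ψ a a a + pairExp ψ d d d - 2 * pairExp ψ a b d := by
  have h := integral_add_mul_sq_eq_pairExp hψ hC ha hb hd (-1)
  simp only [neg_one_mul, ← sub_eq_add_neg] at h
  rw [h]
  ring

theorem pairExp_le_half_add (hψ : Measurable ψ) (hC : ∀ x, |ψ x| ≤ C) (ha : 0 ≤ a) (hd : 0 ≤ d)
    (h : b ^ 2 ≤ a * d) : pairExp ψ a b d ≤ (pairExp ψ a a a + pairExp ψ d d d) / 2 := by
  obtain ⟨p, r, s, hp, hpr, hrs⟩ := exists_pair_factorization ha hd h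
  have hsq := integral_sub_sq_eq_pairExp hψ hC (p := p) (q := 0) (hp.trans (by ring))
    (hpr.trans (by ring)) hrs
  have hnonneg := hsq.symm.trans_ge (integral_nonneg fun w => sq_nonneg _)
  linarith

theorem pairExp_add_pairExp_sub_le {K : ℝ} (hψ : Measurable ψ) (hC : ∀ x, |ψ x| ≤ C)
    (hK : ∀ x y, |ψ x - ψ y| ≤ K * |x - y|) (ha : 0 ≤ a) (hd : 0 ≤ d) (h : b ^ 2 ≤ a * d) :
    pairExp ψ a a a + pairExp ψ d d d - 2 * pairExp ψ a b d ≤ K ^ 2 * (a + d - 2 * b) := by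
  obtain ⟨p, r, s, hp, hpr, hrs⟩ := exists_pair_factorization ha hd h
  have hsq (w : ℝ × ℝ) : (ψ (p * w.1 + 0 * w.2) - ψ (r * w.1 + s * w.2)) ^ 2 ≤
      K ^ 2 * ((p - r) * w.1 + -s * w.2) ^ 2 := by
    have hlip := hK (p * w.1 + 0 * w.2) (r * w.1 + s * w.2)
    calc (ψ (p * w.1 + 0 * w.2) - ψ (r * w.1 + s * w.2)) ^ 2
        ≤ (K * |p * w.1 + 0 * w.2 - (r * w.1 + s * w.2)|) ^ 2 :=
          sq_le_sq' (abs_le.1 hlip).1 (abs_le.1 hlip).2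
      _ = K ^ 2 * ((p - r) * w.1 + -s * w.2) ^ 2 := by
          rw [mul_pow, sq_abs]; ring
  rw [← integral_sub_sq_eq_pairExp hψ hC (p := p) (q := 0) (hp.trans (by ring))
    (hpr.trans (by ring)) hrs]
  calc ∫ w, (ψ (p * w.1 + 0 * w.2) - ψ (r * w.1 + s * w.2)) ^ 2
        ∂((gaussianReal 0 1).prod (gaussianReal 0 1))
      ≤ ∫ w, K ^ 2 * ((p - r) * w.1 + -s * w.2) ^ 2
        ∂((gaussianReal 0 1).prod (gaussianReal 0 1)) :=
        integral_mono_of_nonneg (ae_of_all _ fun w => sq_nonneg _)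
          ((integrable_linear_sq_gaussianReal_prod _ _).const_mul _) (ae_of_all _ hsq)
    _ = K ^ 2 * (a + d - 2 * b) := by
        rw [integral_const_mul, integral_linear_sq_gaussianReal_prod, hp, hpr, hrs]; ring

theorem integral_sub_reflection_sq_le {f f' : ℝ → ℝ} {C C' : ℝ}
    (hf : ∀ x, HasDerivAt f (f' x) x) (hC : ∀ x, |f x| ≤ C) (hC' : ∀ x, |f' x| ≤ C') (u s : ℝ) :
    ∫ v, (f (u + s * v) - f (u + -s * v)) ^ 2 ∂(gaussianReal 0 1) ≤
      ∫ v, (s * (f' (u + s * v) + 1 * f' (u + -s * v))) ^ 2 ∂(gaussianReal 0 1) := by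
  have hlin (s v : ℝ) : HasDerivAt (fun v => f (u + s * v)) (f' (u + s * v) * s) v :=
    (hf _).comp v ((hasDerivAt_const_mul s).const_add u)
  refine integral_sq_le_integral_deriv_sq (C := C + C) (C' := |s| * (C' + C'))
    (fun v => ((hlin s v).sub (hlin (-s) v)).congr_deriv (by ring)) (by simp)
    (fun v => (abs_sub _ _).trans (add_le_add (hC _) (hC _))) fun v => ?_
  rw [abs_mul, one_mul]
  gcongr
  exact (abs_add_le _ _).trans (add_le_add (hC' _) (hC' _))

-- Swapping the two components of a pair with equal variances reflects one coordinate of the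
-- underlying standard Gaussian; this is the Poincaré inequality in that coordinate.
theorem pairExp_self_sub_pairExp_le {f f' : ℝ → ℝ} {C C' Q : ℝ}
    (hf : ∀ x, HasDerivAt f (f' x) x) (hC : ∀ x, |f x| ≤ C) (hC' : ∀ x, |f' x| ≤ C')
    (hb : |b| ≤ Q) : pairExp f Q Q Q - pairExp f Q b Q ≤
      (Q - b) / 2 * (pairExp f' Q Q Q + pairExp f' Q b Q) := by
  have hf_cont : Continuous f := continuous_iff_continuousAt.2 fun x => (hf x).continuousAt
  have hf'_meas : Measurable f' := by
    rw [show f' = deriv f from funext fun x => (hf x).deriv.symm]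
    exact measurable_deriv f
  obtain ⟨hb₁, hb₂⟩ := abs_le.1 hb
  set c := √((Q + b) / 2)
  set s := √((Q - b) / 2)
  have hc : c ^ 2 = (Q + b) / 2 := Real.sq_sqrt (by linarith)
  have hs : s ^ 2 = (Q - b) / 2 := Real.sq_sqrt (by linarith)
  have hX : Q = c ^ 2 + s ^ 2 := by linarith
  have hY : Q = c ^ 2 + (-s) ^ 2 := by linarith [neg_sq s]
  have hXY : b = c * c + s * -s := by linarith
  have hdiff := integral_sub_sq_eq_pairExp hf_cont.measurable hC hX hXY hY
  have hsum := integral_add_mul_sq_eq_pairExp hf'_meas hC' hX hXY hY 1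
  have hprod : ∫ w, (f (c * w.1 + s * w.2) - f (c * w.1 + -s * w.2)) ^ 2
        ∂((gaussianReal 0 1).prod (gaussianReal 0 1)) ≤
      ∫ w, (s * (f' (c * w.1 + s * w.2) + 1 * f' (c * w.1 + -s * w.2))) ^ 2
        ∂((gaussianReal 0 1).prod (gaussianReal 0 1)) := by
    have hint := integrable_add_mul_sq_gaussianReal_prod hf_cont.measurable hC c s c (-s) (-1)
    have hint' := (integrable_add_mul_sq_gaussianReal_prod hf'_meas hC' c s c (-s) 1).const_mul
      (s ^ 2)
    simp only [neg_one_mul, ← sub_eq_add_neg] at hint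
    simp only [← mul_pow] at hint'
    rw [integral_prod _ hint, integral_prod _ hint']
    exact integral_mono hint.integral_prod_left hint'.integral_prod_left
      fun u => integral_sub_reflection_sq_le hf hC hC' (c * u) s
  simp_rw [mul_pow] at hprod
  rw [integral_const_mul, hdiff, hsum, hs] at hprod
  linarith

theorem pairExp_lt_pairExp_self {Q : ℝ} (hψ : Continuous ψ) (hC : ∀ x, |ψ x| ≤ C) {x y : ℝ}
    (hxy : ψ x ≠ ψ y) (hb : |b| < Q) : pairExp ψ Q b Q < pairExp ψ Q Q Q := by
  obtain ⟨hb₁, hb₂⟩ := abs_lt.1 hb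
  set c := √((Q + b) / 2)
  set s := √((Q - b) / 2)
  have hc₀ : c ≠ 0 := Real.sqrt_ne_zero'.2 (by linarith)
  have hs₀ : s ≠ 0 := Real.sqrt_ne_zero'.2 (by linarith)
  have hc : c ^ 2 = (Q + b) / 2 := Real.sq_sqrt (by linarith)
  have hs : s ^ 2 = (Q - b) / 2 := Real.sq_sqrt (by linarith)
  have hdiff := integral_sub_sq_eq_pairExp (a := Q) (b := b) (d := Q) (p := c) (q := s) (r := c)
    (s := -s) hψ.measurable hC (by linarith) (by linarith) (by linarith [neg_sq s])
  have hint := integrable_add_mul_sq_gaussianReal_prod hψ.measurable hC c s c (-s) (-1)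
  simp only [neg_one_mul, ← sub_eq_add_neg] at hint
  have hcont : Continuous fun w : ℝ × ℝ =>
      (ψ (c * w.1 + s * w.2) - ψ (c * w.1 + -s * w.2)) ^ 2 := by fun_prop
  have := (gaussianReal_absolutelyContinuous' 0 one_ne_zero).isOpenPosMeasure
  have hpos : 0 < ∫ w, (ψ (c * w.1 + s * w.2) - ψ (c * w.1 + -s * w.2)) ^ 2
      ∂((gaussianReal 0 1).prod (gaussianReal 0 1)) := by
    rw [integral_pos_iff_support_of_nonneg (fun w => sq_nonneg _) hint]
    refine hcont.isOpen_support.measure_pos _ ⟨((x + y) / (2 * c), (x - y) / (2 * s)), ?_⟩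
    have hx : c * ((x + y) / (2 * c)) + s * ((x - y) / (2 * s)) = x := by field
    have hy : c * ((x + y) / (2 * c)) + -s * ((x - y) / (2 * s)) = y := by field
    simp only [Function.mem_support, hx, hy]
    exact pow_ne_zero 2 (sub_ne_zero.2 hxy)
  linarith

end BoundedPairs

section TanhPairs

open Real (tanh sinh cosh)

variable {a b d p r s : ℝ}

/-- The average of `tanh (p x) tanh (r x + s y)` and `tanh (p x) tanh (r x - s y)`, written so that
its sign and its monotonicity in `|s|` are visible. -/
noncomputable def tanhMulSymm (p r s : ℝ) (w : ℝ × ℝ) : ℝ :=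
  tanh (p * w.1) * sinh (2 * (r * w.1)) / (cosh (2 * (r * w.1)) + cosh (2 * (s * w.2)))

theorem tanhMulSymm_eq (p r s : ℝ) (w : ℝ × ℝ) : tanhMulSymm p r s w =
    2⁻¹ * (tanh (p * w.1 + 0 * w.2) * tanh (r * w.1 + s * w.2) +
      tanh (p * w.1 + 0 * w.2) * tanh (r * w.1 + -s * w.2)) := by
  rw [← mul_add, neg_mul, ← sub_eq_add_neg, tanh_add_tanh_sub, tanhMulSymm, zero_mul, add_zero]
  ring

theorem integrable_tanhMulSymm (p r s : ℝ) :
    Integrable (tanhMulSymm p r s) ((gaussianReal 0 1).prod (gaussianReal 0 1)) := by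
  have hint := integrable_comp_mul_comp_gaussianReal_prod continuous_tanh.measurable
    abs_tanh_le_one p 0 r
  exact funext (tanhMulSymm_eq p r s) ▸ ((hint s).add (hint (-s))).const_mul 2⁻¹

theorem pairExp_tanh_eq_integral (ha : a = p ^ 2) (hb : b = p * r) (hd : d = r ^ 2 + s ^ 2) :
    pairExp tanh a b d =
      ∫ w, tanhMulSymm p r s w ∂((gaussianReal 0 1).prod (gaussianReal 0 1)) := by
  have hint := integrable_comp_mul_comp_gaussianReal_prod continuous_tanh.measurable
    abs_tanh_le_one p 0 r
  have hpair (s : ℝ) (hd : d = r ^ 2 + s ^ 2) :=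
    pairExp_eq_integral_prod continuous_tanh.measurable (p := p) (q := 0) (s := s)
      (ha.trans (by ring)) (hb.trans (by ring)) hd
  simp_rw [tanhMulSymm_eq]
  rw [integral_const_mul, integral_add (hint s) (hint (-s)), ← hpair s hd,
    ← hpair (-s) (by rw [hd, neg_sq])]
  ring

theorem tanhMulSymm_num_nonneg (h : 0 ≤ p * r) (x : ℝ) : 0 ≤ tanh (p * x) * sinh (2 * (r * x)) :=
  tanh_mul_sinh_nonneg (by nlinarith [mul_nonneg h (sq_nonneg x)])

theorem tanhMulSymm_nonneg (h : 0 ≤ p * r) (w : ℝ × ℝ) : 0 ≤ tanhMulSymm p r s w :=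
  div_nonneg (tanhMulSymm_num_nonneg h _) (add_pos (Real.cosh_pos _) (Real.cosh_pos _)).le

theorem tanhMulSymm_le_of_abs_le {s' : ℝ} (h : 0 ≤ p * r) (hs : |s| ≤ |s'|) (w : ℝ × ℝ) :
    tanhMulSymm p r s' w ≤ tanhMulSymm p r s w := by
  refine div_le_div_of_nonneg_left (tanhMulSymm_num_nonneg h _)
    (add_pos (Real.cosh_pos _) (Real.cosh_pos _)) ?_
  gcongr
  rw [Real.cosh_le_cosh]
  simp only [abs_mul]
  gcongr

theorem pairExp_tanh_nonneg (ha : 0 ≤ a) (hd : 0 ≤ d) (h : b ^ 2 ≤ a * d) (hb : 0 ≤ b) :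
    0 ≤ pairExp tanh a b d := by
  obtain ⟨p, r, s, hp, hpr, hrs⟩ := exists_pair_factorization ha hd h
  rw [pairExp_tanh_eq_integral hp hpr hrs]
  exact integral_nonneg fun w => tanhMulSymm_nonneg (hpr ▸ hb) w

theorem pairExp_tanh_antitone_right {d' : ℝ} (ha : 0 ≤ a) (hd : 0 ≤ d) (hdd' : d ≤ d')
    (h : b ^ 2 ≤ a * d) (hb : 0 ≤ b) : pairExp tanh a b d' ≤ pairExp tanh a b d := by
  obtain ⟨p, r, s, hp, hpr, hrs⟩ := exists_pair_factorization ha hd h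
  have hs : |s| ≤ |√(d' - r ^ 2)| := by
    rw [abs_of_nonneg (Real.sqrt_nonneg _)]
    exact Real.abs_le_sqrt (by linarith)
  have hrs' : d' = r ^ 2 + √(d' - r ^ 2) ^ 2 := by
    rw [Real.sq_sqrt (by linarith [sq_nonneg s])]
    ring
  rw [pairExp_tanh_eq_integral hp hpr hrs, pairExp_tanh_eq_integral hp hpr hrs']
  exact integral_mono (integrable_tanhMulSymm p r _) (integrable_tanhMulSymm p r s)
    fun w => tanhMulSymm_le_of_abs_le (hpr ▸ hb) hs w

theorem pairExp_tanh_antitone {Q : ℝ} (ha : 0 ≤ a) (haQ : a ≤ Q) (hd : 0 ≤ d) (hdQ : d ≤ Q)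
    (h : b ^ 2 ≤ a * d) (hb : 0 ≤ b) : pairExp tanh Q b Q ≤ pairExp tanh a b d := by
  have hQ : 0 ≤ Q := ha.trans haQ
  have haQ' : b ^ 2 ≤ a * Q := h.trans (by gcongr)
  calc pairExp tanh Q b Q ≤ pairExp tanh Q b a :=
        pairExp_tanh_antitone_right hQ ha haQ (by linarith) hb
    _ = pairExp tanh a b Q := pairExp_comm continuous_tanh.measurable hQ ha (by linarith)
    _ ≤ pairExp tanh a b d := pairExp_tanh_antitone_right ha hd hdQ h hb

end TanhPairs

section PairContinuity

variable {ψ : ℝ → ℝ} {a b d q C K : ℝ}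

theorem continuousAt_pairExp_self (hψ : Continuous ψ) (hC : ∀ x, |ψ x| ≤ C) (hb : |b| < q) :
    ContinuousAt (fun z : ℝ × ℝ => pairExp ψ z.1 z.2 z.1) (q, b) := by
  have hcont : Continuous fun z : ℝ × ℝ => ∫ w, ψ (√((z.1 + z.2) / 2) * w.1 +
      √((z.1 - z.2) / 2) * w.2) * ψ (√((z.1 + z.2) / 2) * w.1 + -√((z.1 - z.2) / 2) * w.2)
      ∂((gaussianReal 0 1).prod (gaussianReal 0 1)) :=
    continuous_of_dominated (bound := fun _ => C * C)
      (fun z => Continuous.aestronglyMeasurable (by fun_prop))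
      (fun z => ae_of_all _ fun w => by
        rw [norm_mul]
        exact mul_le_mul (hC _) (hC _) (norm_nonneg _) ((abs_nonneg _).trans (hC 0)))
      (integrable_const _) (ae_of_all _ fun w => by fun_prop)
  refine hcont.continuousAt.congr ?_
  filter_upwards [(isOpen_lt (by fun_prop) (by fun_prop)).mem_nhds
    (show (q, b) ∈ {z : ℝ × ℝ | |z.2| < z.1} from hb)] with z hz
  obtain ⟨hz₁, hz₂⟩ := abs_lt.1 hz
  have hc : √((z.1 + z.2) / 2) ^ 2 = (z.1 + z.2) / 2 := Real.sq_sqrt (by linarith)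
  have hs : √((z.1 - z.2) / 2) ^ 2 = (z.1 - z.2) / 2 := Real.sq_sqrt (by linarith)
  exact (pairExp_eq_integral_prod hψ.measurable (by linarith) (by linarith)
    (by linarith [neg_sq √((z.1 - z.2) / 2)])).symm

theorem abs_sqrt_sub_sqrt_le (ha : 0 ≤ a) (hq : 0 < q) : |√a - √q| ≤ |a - q| / √q := by
  rw [le_div_iff₀ (Real.sqrt_pos.2 hq)]
  calc |√a - √q| * √q ≤ |√a - √q| * (√a + √q) := by
        gcongr
        exact le_add_of_nonneg_left (Real.sqrt_nonneg a)
    _ = |√a ^ 2 - √q ^ 2| := by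
        rw [sq_sub_sq, abs_mul, abs_of_nonneg (by positivity : 0 ≤ √a + √q), mul_comm]
    _ = |a - q| := by rw [Real.sq_sqrt ha, Real.sq_sqrt hq.le]

theorem integrable_comp_mul_sq_gaussianReal (hψ : Measurable ψ) (hC : ∀ x, |ψ x| ≤ C) (c : ℝ) :
    Integrable (fun x => ψ (c * x) ^ 2) (gaussianReal 0 1) :=
  .of_bound (C := C ^ 2) ((hψ.comp (measurable_const_mul c)).pow_const 2).aestronglyMeasurable
    (ae_of_all _ fun x => by
      rw [norm_pow]
      exact pow_le_pow_left₀ (norm_nonneg _) (hC _) 2)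

theorem abs_pairExp_self_sub_le (hψ : Measurable ψ) (hC : ∀ x, |ψ x| ≤ C)
    (hK : ∀ x y, |ψ x - ψ y| ≤ K * |x - y|) (ha : 0 ≤ a) (hd : 0 ≤ d) :
    |pairExp ψ a a a - pairExp ψ d d d| ≤ 2 * C * K * |√a - √d| := by
  have hC₀ : 0 ≤ C := (abs_nonneg _).trans (hC 0)
  have hK₀ : 0 ≤ K := by simpa using (abs_nonneg _).trans (hK 1 0)
  have hpt (x : ℝ) : |ψ (√a * x) ^ 2 - ψ (√d * x) ^ 2| ≤
      C * K * |√a - √d| * (1 + x ^ 2) := by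
    have hsum : |ψ (√a * x) + ψ (√d * x)| ≤ 2 * C :=
      (abs_add_le _ _).trans (by linarith [hC (√a * x), hC (√d * x)])
    have hdiff : |ψ (√a * x) - ψ (√d * x)| ≤ K * (|√a - √d| * |x|) := by
      rw [← abs_mul, sub_mul]
      exact hK _ _
    calc |ψ (√a * x) ^ 2 - ψ (√d * x) ^ 2|
        = |ψ (√a * x) + ψ (√d * x)| * |ψ (√a * x) - ψ (√d * x)| := by rw [sq_sub_sq, abs_mul]
      _ ≤ 2 * C * (K * (|√a - √d| * |x|)) := by gcongr
      _ = C * K * |√a - √d| * (2 * 1 * |x|) := by ring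
      _ ≤ C * K * |√a - √d| * (1 ^ 2 + |x| ^ 2) := by
          gcongr
          exact two_mul_le_add_sq 1 |x|
      _ = C * K * |√a - √d| * (1 + x ^ 2) := by rw [one_pow, sq_abs]
  have hsq : Integrable (fun x : ℝ => x ^ 2) (gaussianReal 0 1) :=
    IsGaussian.memLp_two_id.integrable_sq
  have hint : Integrable (fun x : ℝ => C * K * |√a - √d| * (1 + x ^ 2)) (gaussianReal 0 1) :=
    ((integrable_const 1).add hsq).const_mul _
  rw [pairExp_self hψ ha, pairExp_self hψ hd,
    ← integral_sub (integrable_comp_mul_sq_gaussianReal hψ hC _)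
      (integrable_comp_mul_sq_gaussianReal hψ hC _)]
  calc |∫ x, (ψ (√a * x) ^ 2 - ψ (√d * x) ^ 2) ∂(gaussianReal 0 1)|
      ≤ ∫ x, C * K * |√a - √d| * (1 + x ^ 2) ∂(gaussianReal 0 1) :=
        norm_integral_le_of_norm_le (f := fun x => ψ (√a * x) ^ 2 - ψ (√d * x) ^ 2) hint
          (ae_of_all _ hpt)
    _ = 2 * C * K * |√a - √d| := by
        rw [integral_const_mul, integral_add (integrable_const 1) hsq, integral_sq_gaussianReal]
        simp only [integral_const, probReal_univ, one_smul]
        ring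

theorem abs_pairExp_sub_pairExp_self_le {ε : ℝ} (hψ : Measurable ψ) (hC : ∀ x, |ψ x| ≤ C)
    (hK : ∀ x y, |ψ x - ψ y| ≤ K * |x - y|) (hq : 0 < q) (ha : 0 ≤ a) (hd : 0 ≤ d)
    (h : b ^ 2 ≤ a * d) (haε : |a - q| ≤ ε) (hbε : |b - q| ≤ ε) (hdε : |d - q| ≤ ε) :
    |pairExp ψ a b d - pairExp ψ q q q| ≤ (2 * C * K / √q + 2 * K ^ 2) * ε := by
  have hC₀ : 0 ≤ C := (abs_nonneg _).trans (hC 0)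
  have hK₀ : 0 ≤ K := by simpa using (abs_nonneg _).trans (hK 1 0)
  have hself {x : ℝ} (hx : 0 ≤ x) (hxε : |x - q| ≤ ε) :
      |pairExp ψ x x x - pairExp ψ q q q| ≤ 2 * C * K / √q * ε :=
    calc |pairExp ψ x x x - pairExp ψ q q q| ≤ 2 * C * K * |√x - √q| :=
          abs_pairExp_self_sub_le hψ hC hK hx hq.le
      _ ≤ 2 * C * K * (ε / √q) := by
          gcongr
          exact (abs_sqrt_sub_sqrt_le hx hq).trans (by gcongr)
      _ = 2 * C * K / √q * ε := by ring
  have hupper := pairExp_le_half_add hψ hC ha hd h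
  have hlower := pairExp_add_pairExp_sub_le hψ hC hK ha hd h
  have hvar : K ^ 2 * (a + d - 2 * b) ≤ K ^ 2 * (4 * ε) := by
    gcongr
    linarith [(abs_le.1 haε).2, (abs_le.1 hbε).1, (abs_le.1 hdε).2]
  have hnonneg : 0 ≤ K ^ 2 * ε := mul_nonneg (sq_nonneg K) ((abs_nonneg _).trans haε)
  obtain ⟨ha₁, ha₂⟩ := abs_le.1 (hself ha haε)
  obtain ⟨hd₁, hd₂⟩ := abs_le.1 (hself hd hdε)
  rw [abs_le]
  constructor <;> linarith [hnonneg]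

end PairContinuity

section TanhVariance

open Real (tanh)

variable {a b q Q : ℝ}

theorem pairExp_tanh_zero (hq : 0 ≤ q) : pairExp tanh q 0 q = 0 := by
  rw [pairExp_tanh_eq_integral (p := √q) (r := 0) (s := √q) (Real.sq_sqrt hq).symm (by ring)
    (by rw [Real.sq_sqrt hq]; ring)]
  simp [tanhMulSymm]

theorem pairExp_tanh_self_nonneg (ha : 0 ≤ a) : 0 ≤ pairExp tanh a a a :=
  pairExp_tanh_nonneg ha ha (sq a).le ha

theorem pairExp_tanh_self_mono (ha : 0 ≤ a) (haQ : a ≤ Q) :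
    pairExp tanh a a a ≤ pairExp tanh Q Q Q := by
  have hint := integrable_comp_mul_sq_gaussianReal continuous_tanh.measurable abs_tanh_le_one
  rw [pairExp_self continuous_tanh.measurable ha,
    pairExp_self continuous_tanh.measurable (ha.trans haQ)]
  refine integral_mono (hint _) (hint _) fun x => tanh_sq_le_of_abs_le ?_
  simp only [abs_mul, abs_of_nonneg (Real.sqrt_nonneg _)]
  gcongr

theorem mul_pairExp_tanh_self_le (ha : 0 ≤ a) (haQ : a ≤ Q) :
    a * pairExp tanh Q Q Q ≤ Q * pairExp tanh a a a := by
  obtain rfl | ha := ha.eq_or_lt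
  · rw [zero_mul]
    exact mul_nonneg haQ (pairExp_tanh_self_nonneg le_rfl)
  have hQ : 0 < Q := ha.trans_le haQ
  have hint := integrable_comp_mul_sq_gaussianReal continuous_tanh.measurable abs_tanh_le_one
  rw [pairExp_self continuous_tanh.measurable ha.le,
    pairExp_self continuous_tanh.measurable hQ.le, ← integral_const_mul, ← integral_const_mul]
  refine integral_mono ((hint _).const_mul _) ((hint _).const_mul _) fun x => ?_
  have hs : 0 < √a := Real.sqrt_pos.2 ha
  have hscale := tanh_mul_sq_le ((one_le_div hs).2 (Real.sqrt_le_sqrt haQ)) (√a * x)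
  rw [← mul_assoc, div_mul_cancel₀ _ hs.ne', div_pow, Real.sq_sqrt ha.le,
    Real.sq_sqrt hQ.le] at hscale
  calc a * tanh (√Q * x) ^ 2 ≤ a * (Q / a * tanh (√a * x) ^ 2) := by gcongr
    _ = Q * tanh (√a * x) ^ 2 := by field

theorem pairExp_sechSq_self_antitone (hq : 0 ≤ q) (hqQ : q ≤ Q) :
    pairExp sechSq Q Q Q ≤ pairExp sechSq q q q := by
  have hint := integrable_comp_mul_sq_gaussianReal continuous_sechSq.measurable abs_sechSq_le_one
  rw [pairExp_self continuous_sechSq.measurable hq,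
    pairExp_self continuous_sechSq.measurable (hq.trans hqQ)]
  refine integral_mono (hint _) (hint _) fun x => pow_le_pow_left₀ (sechSq_pos _).le
    (sub_le_sub_left (tanh_sq_le_of_abs_le ?_) 1) 2
  simp only [abs_mul, abs_of_nonneg (Real.sqrt_nonneg _)]
  gcongr

theorem pairExp_tanh_self_sub_lt (hb : |b| < Q) :
    pairExp tanh Q Q Q - pairExp tanh Q b Q < pairExp sechSq Q Q Q * (Q - b) := by
  have hpos : 0 < Q - b := sub_pos.2 ((le_abs_self b).trans_lt hb)
  have hne : sechSq 0 ≠ sechSq 1 := by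
    have hne : tanh 1 ≠ tanh 0 := (tanh_strictMono one_pos).ne'
    simpa [sechSq, eq_comm (a := (1 : ℝ))] using hne
  calc pairExp tanh Q Q Q - pairExp tanh Q b Q
      ≤ (Q - b) / 2 * (pairExp sechSq Q Q Q + pairExp sechSq Q b Q) :=
        pairExp_self_sub_pairExp_le hasDerivAt_tanh abs_tanh_le_one abs_sechSq_le_one hb.le
    _ < (Q - b) / 2 * (pairExp sechSq Q Q Q + pairExp sechSq Q Q Q) := by
        gcongr
        exact pairExp_lt_pairExp_self continuous_sechSq abs_sechSq_le_one hne hb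
    _ = pairExp sechSq Q Q Q * (Q - b) := by ring

theorem pairExp_tanh_self_sub_le (hb : |b| ≤ Q) :
    pairExp tanh Q Q Q - pairExp tanh Q b Q ≤ pairExp sechSq Q Q Q * (Q - b) := by
  have hQ : 0 ≤ Q := (abs_nonneg b).trans hb
  have hle : pairExp sechSq Q b Q ≤ pairExp sechSq Q Q Q := by
    simpa using pairExp_le_half_add continuous_sechSq.measurable abs_sechSq_le_one hQ hQ
      (by simpa [sq] using abs_le_iff_mul_self_le.1 (hb.trans (le_abs_self Q)))
  have hnonneg : 0 ≤ (Q - b) / 2 := by linarith [le_abs_self b]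
  linarith [pairExp_self_sub_pairExp_le hasDerivAt_tanh abs_tanh_le_one abs_sechSq_le_one hb,
    mul_le_mul_of_nonneg_left hle hnonneg]

end TanhVariance

section TanhCritical

open Filter Topology
open Real (tanh)

/-- The edge of chaos of `tanh` at the variance `q`, expressed through `pairExp` so that it can be
compared with the covariance map at other arguments. -/
structure TanhCritical (q σw σb : ℝ) : Prop where
  pos : 0 < q
  variance_eq : σw ^ 2 * pairExp tanh q q q + σb ^ 2 = q
  slope_eq : σw ^ 2 * pairExp sechSq q q q = 1

theorem exists_tanhCritical_of_edgeOfChaos {σw σb : ℝ} (h : EdgeOfChaos tanh σw σb) :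
    ∃ q, TanhCritical q σw σb := by
  obtain ⟨q, hq, hvar, hslope⟩ := h
  rw [deriv_tanh] at hslope
  refine ⟨q, hq, ?_, ?_⟩
  · rwa [pairExp_self continuous_tanh.measurable hq.le]
  · rwa [pairExp_self continuous_sechSq.measurable hq.le]

namespace TanhCritical

variable {q σw σb a b d M : ℝ}

theorem sq_weight_pos (hc : TanhCritical q σw σb) : 0 < σw ^ 2 := by
  refine (sq_nonneg σw).lt_of_ne' fun h => ?_
  simpa [h] using hc.slope_eq

theorem lt_cov (hc : TanhCritical q σw σb) (hb : |b| < q) :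
    b < σw ^ 2 * pairExp tanh q b q + σb ^ 2 := by
  have hgap := mul_lt_mul_of_pos_left (pairExp_tanh_self_sub_lt hb) hc.sq_weight_pos
  rw [← mul_assoc, hc.slope_eq] at hgap
  linarith [hc.variance_eq]

theorem sq_bias_pos (hc : TanhCritical q σw σb) : 0 < σb ^ 2 := by
  simpa [pairExp_tanh_zero hc.pos.le] using hc.lt_cov (b := 0) (by simpa using hc.pos)

theorem ratio_mem_Ico (hc : TanhCritical q σw σb) : 1 - σb ^ 2 / q ∈ Set.Ico (0 : ℝ) 1 := by
  have hle : σb ^ 2 ≤ q := by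
    linarith [hc.variance_eq, mul_nonneg (sq_nonneg σw) (pairExp_tanh_self_nonneg hc.pos.le)]
  exact ⟨sub_nonneg.2 ((div_le_one hc.pos).2 hle),
    sub_lt_self 1 (div_pos hc.sq_bias_pos hc.pos)⟩

theorem ratio_mul_add (hc : TanhCritical q σw σb) (x : ℝ) :
    x / q * (σw ^ 2 * pairExp tanh q q q) + σb ^ 2 = q + (1 - σb ^ 2 / q) * (x - q) := by
  have hq := hc.pos.ne'
  rw [eq_sub_of_add_eq hc.variance_eq]
  field

theorem variance_le (hc : TanhCritical q σw σb) (hM : q ≤ M) :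
    σw ^ 2 * pairExp tanh M M M + σb ^ 2 ≤ q + (1 - σb ^ 2 / q) * (M - q) := by
  rw [← hc.ratio_mul_add, mul_left_comm]
  gcongr
  rw [div_mul_eq_mul_div, le_div_iff₀' hc.pos]
  exact mul_pairExp_tanh_self_le hc.pos.le hM

theorem le_variance (hc : TanhCritical q σw σb) (ha : 0 ≤ a) (haq : a ≤ q) :
    q + (1 - σb ^ 2 / q) * (a - q) ≤ σw ^ 2 * pairExp tanh a a a + σb ^ 2 := by
  rw [← hc.ratio_mul_add, mul_left_comm]
  gcongr
  rw [div_mul_eq_mul_div, div_le_iff₀' hc.pos]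
  exact mul_pairExp_tanh_self_le ha haq

theorem le_variance_of_ge (hc : TanhCritical q σw σb) (hM : q ≤ M) :
    q ≤ σw ^ 2 * pairExp tanh M M M + σb ^ 2 := by
  nth_rewrite 1 [← hc.variance_eq]
  gcongr
  exact pairExp_tanh_self_mono hc.pos.le hM

theorem cov_le (hc : TanhCritical q σw σb) (ha : 0 ≤ a) (hd : 0 ≤ d) (h : b ^ 2 ≤ a * d)
    (haM : a ≤ M) (hdM : d ≤ M) (hM : q ≤ M) :
    σw ^ 2 * pairExp tanh a b d + σb ^ 2 ≤ q + (1 - σb ^ 2 / q) * (M - q) := by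
  refine le_trans ?_ (hc.variance_le hM)
  gcongr
  linarith [pairExp_le_half_add continuous_tanh.measurable abs_tanh_le_one ha hd h,
    pairExp_tanh_self_mono ha haM, pairExp_tanh_self_mono hd hdM]

theorem le_cov (hc : TanhCritical q σw σb) (ha : 0 ≤ a) (hd : 0 ≤ d) (h : b ^ 2 ≤ a * d)
    (haM : a ≤ M) (hdM : d ≤ M) (hM : q ≤ M) (hb : 0 ≤ b) :
    b - (M - q) ≤ σw ^ 2 * pairExp tanh a b d + σb ^ 2 := by
  have hM₀ : 0 ≤ M := hc.pos.le.trans hM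
  have hbM : |b| ≤ M := abs_le_of_sq_le_sq (h.trans (by rw [sq]; gcongr)) hM₀
  have hslope : pairExp sechSq M M M * (M - b) ≤ pairExp sechSq q q q * (M - b) :=
    mul_le_mul_of_nonneg_right (pairExp_sechSq_self_antitone hc.pos.le hM)
      (sub_nonneg.2 ((le_abs_self b).trans hbM))
  have hgap : σw ^ 2 * (pairExp tanh M M M - pairExp sechSq q q q * (M - b)) ≤
      σw ^ 2 * pairExp tanh a b d := by
    gcongr
    linarith [pairExp_tanh_antitone ha haM hd hdM h hb, pairExp_tanh_self_sub_le hbM]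
  rw [mul_sub, ← mul_assoc, hc.slope_eq] at hgap
  linarith [hc.le_variance_of_ge hM]

theorem eventually_add_lt_cov (hc : TanhCritical q σw σb) :
    ∀ᶠ ε in 𝓝 (0 : ℝ), ∀ b ∈ Set.Icc 0 (3 / 4 * q),
      b + ε < σw ^ 2 * pairExp tanh (q + ε) b (q + ε) + σb ^ 2 := by
  refine isCompact_Icc.eventually_forall_of_forall_eventually fun b hb => ?_
  have hbq : |b| < q := by
    rw [abs_of_nonneg hb.1]
    linarith [hb.2, hc.pos]
  have hshift : ContinuousAt (fun z : ℝ × ℝ => (q + z.1, z.2)) (0, b) := by fun_prop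
  have hpair : ContinuousAt (fun z : ℝ × ℝ => pairExp tanh (q + z.1) z.2 (q + z.1)) (0, b) :=
    ContinuousAt.comp (f := fun z : ℝ × ℝ => (q + z.1, z.2))
      (g := fun z : ℝ × ℝ => pairExp tanh z.1 z.2 z.1)
      (by simpa using continuousAt_pairExp_self continuous_tanh abs_tanh_le_one hbq) hshift
  refine ContinuousAt.eventually_lt (by fun_prop) ((hpair.const_mul _).add_const _) ?_
  simpa using hc.lt_cov hbq

theorem exists_min_add_le_cov (hc : TanhCritical q σw σb) :
    ∃ ε > 0, ε ≤ q / 12 ∧ ∀ {a b d : ℝ}, 0 ≤ a → 0 ≤ d → b ^ 2 ≤ a * d → a ≤ q + ε → d ≤ q + ε →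
      0 ≤ b → min (b + ε) (2 / 3 * q) ≤ σw ^ 2 * pairExp tanh a b d + σb ^ 2 := by
  have hq := hc.pos
  obtain ⟨ε, hgap, hε, hεq⟩ := ((hc.eventually_add_lt_cov.filter_mono nhdsWithin_le_nhds).and
    (Ioc_mem_nhdsGT (by positivity : 0 < q / 12))).exists
  refine ⟨ε, hε, hεq, fun {a b d} ha hd h haε hdε hb => ?_⟩
  obtain hbq | hbq := le_total b (3 / 4 * q)
  · calc min (b + ε) (2 / 3 * q) ≤ b + ε := min_le_left _ _
      _ ≤ σw ^ 2 * pairExp tanh (q + ε) b (q + ε) + σb ^ 2 := (hgap b ⟨hb, hbq⟩).le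
      _ ≤ σw ^ 2 * pairExp tanh a b d + σb ^ 2 := by
        gcongr
        exact pairExp_tanh_antitone ha haε hd hdε h hb
  · calc min (b + ε) (2 / 3 * q) ≤ 2 / 3 * q := min_le_right _ _
      _ ≤ b - (q + ε - q) := by linarith
      _ ≤ σw ^ 2 * pairExp tanh a b d + σb ^ 2 :=
        hc.le_cov ha hd h haε hdε (le_add_of_nonneg_right hε.le) hb

end TanhCritical

end TanhCritical

section Replica

open Matrix

variable {V : Type*} {S N : V → V → ℝ}

/-- `S` is the common covariance, and `N` the symmetric cross covariance, of a pair of centred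
Gaussian fields on `V`. It makes `N` a lower bound for `S` up to the defects `S u u - N u u`. -/
def IsReplicaPair (S N : V → V → ℝ) : Prop :=
  (fromBlocks (of S) (of N) (of N) (of S)).PosSemidef

namespace IsReplicaPair

theorem posSemidef (h : IsReplicaPair S N) : (of S).PosSemidef :=
  PosSemidef.submatrix h Sum.inl

theorem fromBlocks_symm (h : IsReplicaPair S N) (x y : V ⊕ V) :
    fromBlocks (of S) (of N) (of N) (of S) y x = fromBlocks (of S) (of N) (of N) (of S) x y :=
  symm_of_posSemidef (S := fromBlocks (of S) (of N) (of N) (of S)) h x y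

theorem cross_symm (h : IsReplicaPair S N) (u v : V) : N v u = N u v :=
  h.fromBlocks_symm (.inl u) (.inr v)

theorem sq_le (h : IsReplicaPair S N) (u v : V) : N u v ^ 2 ≤ S u u * S v v :=
  sq_le_mul_of_posSemidef (S := fromBlocks (of S) (of N) (of N) (of S)) h (.inl u) (.inr v)

theorem sub_half_le (h : IsReplicaPair S N) (u v : V) :
    N u v - ((S u u - N u u) + (S v v - N v v)) / 2 ≤ S u v := by
  have hquad := (PosSemidef.submatrix h
    ![Sum.inl u, Sum.inr u, Sum.inl v, Sum.inr v]).dotProduct_mulVec_nonneg ![1, -1, 1, -1]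
  have hexpand : 0 ≤ 2 * (S u u - N u u) + 2 * (S v v - N v v) + 4 * (S u v - N u v) := by
    refine hquad.trans_eq ?_
    simp [mulVec, dotProduct, Fin.sum_univ_four, symm_of_posSemidef h.posSemidef u v,
      h.cross_symm u v]
    ring
  linarith

theorem zero [Finite V] (hS : (of S).PosSemidef) : IsReplicaPair S 0 := by
  have := Fintype.ofFinite V
  refine .of_dotProduct_mulVec_nonneg
    (hS.isHermitian.fromBlocks conjTranspose_zero hS.isHermitian) fun x => ?_
  obtain ⟨y, z, rfl⟩ : ∃ y z, x = Sum.elim y z := ⟨_, _, (Sum.elim_comp_inl_inr x).symm⟩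
  rw [fromBlocks_mulVec]
  simpa [sumElim_dotProduct_sumElim] using
    add_nonneg (hS.dotProduct_mulVec_nonneg y) (hS.dotProduct_mulVec_nonneg z)

theorem covStep [Finite V] {φ : ℝ → ℝ} (hφ : Measurable φ) (hle : ∀ x, |φ x| ≤ |x|)
    (σw σb : ℝ) (h : IsReplicaPair S N) : IsReplicaPair (covStep φ σw σb S)
      fun u v => σw ^ 2 * pairExp φ (S u u) (N u v) (S v v) + σb ^ 2 := by
  unfold IsReplicaPair
  convert posSemidef_covStep hφ hle σw σb (S := fromBlocks (of S) (of N) (of N) (of S)) h using 1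
  ext x y
  rw [of_apply, covStep_eq_pairExp φ σw σb (h.fromBlocks_symm x y)]
  rcases x with u | u <;> rcases y with v | v <;>
    simp [covStep_eq_pairExp, symm_of_posSemidef h.posSemidef u v]

theorem aggregate [Fintype V] [DecidableEq V] (G : SimpleGraph V) [DecidableRel G.Adj]
    (h : IsReplicaPair S N) : IsReplicaPair (aggregate G S) (aggregate G N) := by
  unfold IsReplicaPair
  convert PosSemidef.mul_mul_conjTranspose_same h
    (fromBlocks (avgMatrix G) 0 0 (avgMatrix G)) using 1
  rw [fromBlocks_conjTranspose]
  simp [fromBlocks_multiply, of_aggregate]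

end IsReplicaPair

variable [Fintype V] [DecidableEq V] (G : SimpleGraph V) [DecidableRel G.Adj] {d : ℕ}
  (h : V → EuclideanSpace ℝ (Fin d)) (φ : ℝ → ℝ) (σw σb : ℝ) (R : ℕ)

/-- The covariance between two copies of the infinitely wide network that share only their biases:
the same recursion as for `gpk`, started from `0`. -/
noncomputable def crossKernel : ℕ → ℕ → V → V → ℝ
  | 0, 0 => 0
  | l + 1, 0 => aggregate G (crossKernel l R)
  | l, r + 1 => fun u v => σw ^ 2 * pairExp φ (gpk G h φ σw σb R l r u u)
      (crossKernel l r u v) (gpk G h φ σw σb R l r v v) + σb ^ 2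

variable {G h φ σw σb R}

theorem crossKernel_zero_zero : crossKernel G h φ σw σb R 0 0 = 0 := by
  simp only [crossKernel]

theorem crossKernel_succ_zero (l : ℕ) :
    crossKernel G h φ σw σb R (l + 1) 0 = aggregate G (crossKernel G h φ σw σb R l R) := by
  simp only [crossKernel]

theorem crossKernel_succ (l r : ℕ) : crossKernel G h φ σw σb R l (r + 1) = fun u v =>
    σw ^ 2 * pairExp φ (gpk G h φ σw σb R l r u u) (crossKernel G h φ σw σb R l r u v)
      (gpk G h φ σw σb R l r v v) + σb ^ 2 := by
  cases l <;> simp only [crossKernel]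

theorem isReplicaPair_crossKernel (hφ : Measurable φ) (hle : ∀ x, |φ x| ≤ |x|) (l r : ℕ) :
    IsReplicaPair (gpk G h φ σw σb R l r) (crossKernel G h φ σw σb R l r) := by
  refine layer_induction (R := R) ?_ (fun l hl => ?_) (fun l r hr => ?_) l r
  · rw [crossKernel_zero_zero]
    exact .zero (posSemidef_gpk hφ hle 0 0)
  · rw [gpk_succ_zero, crossKernel_succ_zero]
    exact hl.aggregate G
  · rw [gpk_succ, crossKernel_succ]
    exact hr.covStep hφ hle σw σb

end Replica

section TanhKernel

open Filter Topology
open Real (tanh)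

/-- How far the entries of the kernel `S`, vectorized, fall short of the target value `q`. -/
noncomputable def shortfall {V : Type*} (q : ℝ) (S : V → V → ℝ) (p : V × V) : ℝ :=
  max (q - S p.1 p.2) 0

theorem shortfall_nonneg {V : Type*} (q : ℝ) (S : V → V → ℝ) (p : V × V) : 0 ≤ shortfall q S p :=
  le_max_right _ _

theorem sub_le_shortfall {V : Type*} (q : ℝ) (S : V → V → ℝ) (p : V × V) :
    q - S p.1 p.2 ≤ shortfall q S p :=
  le_max_left _ _

theorem abs_sub_le_shortfall_add {V : Type*} {q e : ℝ} {S : V → V → ℝ} {p : V × V} (he : 0 ≤ e)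
    (h : S p.1 p.2 ≤ q + e) : |S p.1 p.2 - q| ≤ shortfall q S p + e :=
  abs_le.2 ⟨by linarith [sub_le_shortfall q S p], by linarith [shortfall_nonneg q S p]⟩

theorem shortfall_aggregate_le {V : Type*} [Fintype V] [DecidableEq V] (G : SimpleGraph V)
    [DecidableRel G.Adj] (q : ℝ) (S : V → V → ℝ) (p : V × V) :
    shortfall q (aggregate G S) p ≤ (aggMatrix G *ᵥ shortfall q S) p := by
  have hA := aggMatrix_mem_rowStochastic G
  refine max_le ?_ (le_mulVec_of_mem_rowStochastic hA (shortfall_nonneg q S) p)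
  have hconst : (aggMatrix G *ᵥ fun p => -S p.1 p.2 + q) p = q - aggregate G S p.1 p.2 := by
    rw [mulVec_add_const_of_mem_rowStochastic hA, ← aggMatrix_mulVec, ← neg_add_eq_sub,
      ← Pi.neg_apply, ← Matrix.mulVec_neg]
    rfl
  rw [← hconst]
  refine mulVec_mono_of_mem_rowStochastic hA (fun p => ?_) p
  rw [neg_add_eq_sub]
  exact sub_le_shortfall q S p

variable {V : Type*} {S : V → V → ℝ} {σw σb q M : ℝ}

namespace TanhCritical

theorem covStep_le (hc : TanhCritical q σw σb) (hS : (Matrix.of S).PosSemidef) (hM : q ≤ M)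
    (hle : ∀ u, S u u ≤ M) (u v : V) :
    covStep tanh σw σb S u v ≤ q + (1 - σb ^ 2 / q) * (M - q) := by
  rw [covStep_eq_pairExp _ _ _ (symm_of_posSemidef hS u v)]
  exact hc.cov_le (diag_nonneg_of_posSemidef hS u) (diag_nonneg_of_posSemidef hS v)
    (sq_le_mul_of_posSemidef hS u v) (hle u) (hle v) hM

theorem shortfall_covStep_le (hc : TanhCritical q σw σb) (hS : (Matrix.of S).PosSemidef)
    (hM : q ≤ M) (hle : ∀ u, S u u ≤ M) {p : V × V} (hp : 0 ≤ S p.1 p.2) :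
    shortfall q (covStep tanh σw σb S) p ≤ shortfall q S p + (M - q) := by
  refine max_le ?_ (add_nonneg (shortfall_nonneg q S p) (sub_nonneg.2 hM))
  rw [covStep_eq_pairExp _ _ _ (symm_of_posSemidef hS p.1 p.2)]
  linarith [sub_le_shortfall q S p, hc.le_cov (diag_nonneg_of_posSemidef hS p.1)
    (diag_nonneg_of_posSemidef hS p.2) (sq_le_mul_of_posSemidef hS p.1 p.2) (hle p.1) (hle p.2)
    hM hp]

theorem shortfall_covStep_diag_le (hc : TanhCritical q σw σb) (hS : (Matrix.of S).PosSemidef)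
    (u : V) : shortfall q (covStep tanh σw σb S) (u, u) ≤
      (1 - σb ^ 2 / q) * shortfall q S (u, u) := by
  have hnonneg := mul_nonneg hc.ratio_mem_Ico.1 (shortfall_nonneg q S (u, u))
  refine max_le ?_ hnonneg
  rw [covStep_eq_pairExp _ _ _ (symm_of_posSemidef hS u u)]
  obtain hq | hq := le_total (S u u) q
  · linarith [hc.le_variance (diag_nonneg_of_posSemidef hS u) hq,
      mul_le_mul_of_nonneg_left (sub_le_shortfall q S (u, u)) hc.ratio_mem_Ico.1]
  · linarith [hc.le_variance_of_ge hq]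

end TanhCritical

variable [Fintype V] [DecidableEq V] {G : SimpleGraph V} [DecidableRel G.Adj] {d : ℕ}
  {h : V → EuclideanSpace ℝ (Fin d)} {R : ℕ}

theorem posSemidef_gpk_tanh (l r : ℕ) : (Matrix.of (gpk G h tanh σw σb R l r)).PosSemidef :=
  posSemidef_gpk continuous_tanh.measurable abs_tanh_le_abs l r

theorem isReplicaPair_crossKernel_tanh (l r : ℕ) :
    IsReplicaPair (gpk G h tanh σw σb R l r) (crossKernel G h tanh σw σb R l r) :=
  isReplicaPair_crossKernel continuous_tanh.measurable abs_tanh_le_abs l r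

theorem crossKernel_tanh_nonneg (l r : ℕ) :
    ∀ u v, 0 ≤ crossKernel G h tanh σw σb R l r u v := by
  refine layer_induction (R := R) (fun u v => ?_) (fun l hl u v => ?_) (fun l r hr u v => ?_) l r
  · rw [crossKernel_zero_zero, Pi.zero_apply, Pi.zero_apply]
  · rw [crossKernel_succ_zero]
    exact le_aggregate G hl u v
  · have hS := posSemidef_gpk_tanh (G := G) (h := h) (σw := σw) (σb := σb) (R := R) l r
    have hpair := pairExp_tanh_nonneg (diag_nonneg_of_posSemidef hS u)
      (diag_nonneg_of_posSemidef hS v) ((isReplicaPair_crossKernel_tanh l r).sq_le u v) (hr u v)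
    rw [crossKernel_succ]
    positivity

theorem exists_gpk_tanh_le (hc : TanhCritical q σw σb) (hR : 0 < R) :
    ∃ E ≥ 0, ∀ l r (u v : V), gpk G h tanh σw σb R l r u v ≤ q + E * (1 - σb ^ 2 / q) ^ l := by
  obtain ⟨hη₀, hη₁⟩ := hc.ratio_mem_Ico
  obtain ⟨B, hB⟩ := (Set.finite_range fun p : V × V => inner ℝ (h p.1) (h p.2)).bddAbove
  refine ⟨max B 0, le_max_right _ _, fun l r u v => ?_⟩
  set E := max B 0
  set η := 1 - σb ^ 2 / q
  have hEη (k : ℕ) : 0 ≤ E * η ^ k := mul_nonneg (le_max_right _ _) (pow_nonneg hη₀ k)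
  have hanti {j k : ℕ} (hjk : j ≤ k) : E * η ^ k ≤ E * η ^ j :=
    mul_le_mul_of_nonneg_left (pow_le_pow_of_le_one hη₀ hη₁.le hjk) (le_max_right _ _)
  -- The first step of layer `l` gains the factor `η` that the bound for layer `l + 1` needs.
  suffices hlayer : ∀ u v, gpk G h tanh σw σb R l r u v ≤ q + E * η ^ (l + min r 1) from
    (hlayer u v).trans (add_le_add_right (hanti le_self_add) q)
  refine layer_induction (R := R) (fun u v => ?_) (fun l hl => ?_) (fun l r hr u v => ?_) l r
  · rw [gpk_zero_zero]
    have hinner : inner ℝ (h u) (h v) ≤ E := (hB ⟨(u, v), rfl⟩).trans (le_max_left _ _)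
    simpa using hinner.trans (le_add_of_nonneg_left hc.pos.le)
  · rw [gpk_succ_zero]
    rw [min_eq_right (Nat.succ_le_of_lt hR)] at hl
    simpa only [zero_min, add_zero] using aggregate_le G hl
  · rw [gpk_succ]
    refine (hc.covStep_le (posSemidef_gpk_tanh l r) (le_add_of_nonneg_right (hEη _))
      (fun u => hr u u) u v).trans ?_
    rw [add_sub_cancel_left, mul_left_comm, ← pow_succ']
    exact add_le_add_right (hanti (by omega)) q

theorem min_le_crossKernel_tanh (hR : 0 < R) {ε : ℝ} (hε : 0 ≤ ε) {l₀ : ℕ}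
    (hle : ∀ l ≥ l₀, ∀ r u, gpk G h tanh σw σb R l r u u ≤ q + ε)
    (hstep : ∀ {a b d : ℝ}, 0 ≤ a → 0 ≤ d → b ^ 2 ≤ a * d → a ≤ q + ε → d ≤ q + ε →
      0 ≤ b → min (b + ε) (2 / 3 * q) ≤ σw ^ 2 * pairExp tanh a b d + σb ^ 2)
    (n r : ℕ) (u v : V) :
    min (n * ε) (2 / 3 * q) ≤ crossKernel G h tanh σw σb R (l₀ + n) r u v := by
  have hmono {j k : ℕ} (hjk : j ≤ k) (c : ℝ) : min (j * ε) c ≤ min (k * ε) c :=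
    min_le_min_right c (mul_le_mul_of_nonneg_right (Nat.cast_le.2 hjk) hε)
  suffices hlayer : ∀ u v, min ((n + min r 1 : ℕ) * ε) (2 / 3 * q) ≤
      crossKernel G h tanh σw σb R (l₀ + n) r u v from (hmono le_self_add _).trans (hlayer u v)
  refine layer_induction (R := R) (fun u v => ?_) (fun n hn => ?_) (fun n r hr u v => ?_) n r
  · simpa using Or.inl (crossKernel_tanh_nonneg l₀ 0 u v)
  · rw [← add_assoc, crossKernel_succ_zero]
    rw [min_eq_right (Nat.succ_le_of_lt hR)] at hn
    simpa only [zero_min, add_zero] using le_aggregate G hn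
  · have hS := posSemidef_gpk_tanh (G := G) (h := h) (σw := σw) (σb := σb) (R := R) (l₀ + n) r
    rw [crossKernel_succ]
    refine le_trans ?_ (hstep (diag_nonneg_of_posSemidef hS u) (diag_nonneg_of_posSemidef hS v)
      ((isReplicaPair_crossKernel_tanh _ r).sq_le u v) (hle _ le_self_add r u)
      (hle _ le_self_add r v) (crossKernel_tanh_nonneg _ r u v))
    refine le_min ((hmono (k := n + min r 1 + 1) (by omega) _).trans ?_) (min_le_right _ _)
    calc min ((n + min r 1 + 1 : ℕ) * ε) (2 / 3 * q)
        ≤ min ((n + min r 1 : ℕ) * ε + ε) (2 / 3 * q + ε) := by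
          refine min_le_min (le_of_eq ?_) (le_add_of_nonneg_right hε)
          push_cast
          ring
      _ ≤ _ := by
          rw [min_add_add_right]
          exact add_le_add_left (hr u v) ε

theorem exists_gpk_tanh_nonneg (hc : TanhCritical q σw σb) (hR : 0 < R) :
    ∃ l₀ : ℕ, ∀ l ≥ l₀, ∀ r (u v : V), 0 ≤ gpk G h tanh σw σb R l r u v := by
  obtain ⟨E, -, hup⟩ := exists_gpk_tanh_le (G := G) (h := h) hc hR
  obtain ⟨ε, hε, hεq, hstep⟩ := hc.exists_min_add_le_cov
  obtain ⟨l₀, hl₀⟩ : ∃ l₀ : ℕ, ∀ l ≥ l₀, E * (1 - σb ^ 2 / q) ^ l < ε := by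
    have hlim := (ExpDecay.pow hc.ratio_mem_Ico).tendsto_zero.const_mul E
    rw [mul_zero] at hlim
    exact eventually_atTop.1 (hlim.eventually (gt_mem_nhds hε))
  have hdiag (l : ℕ) (hl : l ≥ l₀) (r : ℕ) (u : V) : gpk G h tanh σw σb R l r u u ≤ q + ε :=
    (hup l r u u).trans (add_le_add_right (hl₀ l hl).le q)
  obtain ⟨n₀, hn₀⟩ := exists_nat_ge (2 / 3 * q / ε)
  refine ⟨l₀ + n₀, fun l hl r u v => ?_⟩
  obtain ⟨n, rfl⟩ := Nat.exists_eq_add_of_le (le_self_add.trans hl)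
  have hn : 2 / 3 * q ≤ n * ε :=
    (div_le_iff₀ hε).1 (hn₀.trans (Nat.cast_le.2 (by omega)))
  have hcross (u v : V) : 2 / 3 * q ≤ crossKernel G h tanh σw σb R (l₀ + n) r u v := by
    simpa only [min_eq_right hn] using min_le_crossKernel_tanh hR hε.le hdiag hstep n r u v
  have hpair := isReplicaPair_crossKernel_tanh (G := G) (h := h) (σw := σw) (σb := σb) (R := R)
    (l₀ + n) r
  have hl₀' : l₀ + n ≥ l₀ := le_self_add
  linarith [hpair.sub_half_le u v, hcross u v, hcross u u,
    hcross v v, hdiag _ hl₀' r u, hdiag _ hl₀' r v, hc.pos]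

theorem shortfall_gpk_tanh_le (hc : TanhCritical q σw σb) {l : ℕ} (hM : q ≤ M)
    (hle : ∀ r u, gpk G h tanh σw σb R l r u u ≤ M)
    (hnonneg : ∀ r u v, 0 ≤ gpk G h tanh σw σb R l r u v) (r : ℕ) (p : V × V) :
    shortfall q (gpk G h tanh σw σb R l r) p ≤
      shortfall q (gpk G h tanh σw σb R l 0) p + r * (M - q) := by
  induction r with
  | zero => simp
  | succ r ih =>
    have hstep := hc.shortfall_covStep_le (posSemidef_gpk_tanh l r) hM (hle r) (hnonneg r p.1 p.2)
    rw [gpk_succ]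
    push_cast
    linarith

theorem shortfall_gpk_tanh_diag_le (hc : TanhCritical q σw σb) (l r : ℕ) (u : V) :
    shortfall q (gpk G h tanh σw σb R l (r + 1)) (u, u) ≤
      (1 - σb ^ 2 / q) * shortfall q (gpk G h tanh σw σb R l 0) (u, u) := by
  have hstep (r : ℕ) := hc.shortfall_covStep_diag_le
    (posSemidef_gpk_tanh (G := G) (h := h) (σw := σw) (σb := σb) (R := R) l r) u
  induction r with
  | zero => simpa only [gpk_succ] using hstep 0
  | succ r ih =>
    rw [gpk_succ]
    exact (hstep (r + 1)).trans
      ((mul_le_of_le_one_left (shortfall_nonneg _ _ _) hc.ratio_mem_Ico.2.le).trans ih)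

theorem expDecay_gpk_tanh [Nonempty V] (hc : TanhCritical q σw σb) (hR : 0 < R)
    (hirr : (aggMatrix G).IsIrreducible) (r : ℕ) :
    ExpDecay fun l (p : V × V) => gpk G h tanh σw σb R l r p.1 p.2 - q := by
  obtain ⟨E, hE, hup⟩ := exists_gpk_tanh_le (G := G) (h := h) hc hR
  obtain ⟨l₀, hl₀⟩ := exists_gpk_tanh_nonneg (G := G) (h := h) hc hR
  set η := 1 - σb ^ 2 / q
  set S := gpk G h tanh σw σb R
  set ε : ℕ → ℝ := fun l => E * η ^ (l + l₀)
  have hε₀ (l : ℕ) : 0 ≤ ε l := mul_nonneg hE (pow_nonneg hc.ratio_mem_Ico.1 _)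
  have hε : ExpDecay ε := ((ExpDecay.pow hc.ratio_mem_Ico).const_mul E).comp_add l₀
  have hgrow (l r : ℕ) (p : V × V) :
      shortfall q (S (l + l₀) r) p ≤ shortfall q (S (l + l₀) 0) p + r * ε l := by
    simpa only [add_sub_cancel_left] using shortfall_gpk_tanh_le hc
      (le_add_of_nonneg_right (hε₀ l)) (fun r u => hup (l + l₀) r u u) (hl₀ _ le_add_self) r p
  have hshort : ExpDecay fun l => shortfall q (S (l + l₀) 0) := by
    obtain ⟨u₀⟩ := ‹Nonempty V›
    refine expDecay_of_subharmonic_of_loss (aggMatrix_mem_rowStochastic G)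
      (isPrimitive_aggMatrix G hirr) (w := fun l => shortfall q (S (l + l₀) R)) (j₀ := (u₀, u₀))
      (hε.const_mul R) hc.ratio_mem_Ico (fun l => shortfall_nonneg _ _)
      (fun l p => ?_) (fun l => hgrow l R) fun l => ?_
    · rw [add_right_comm]
      simpa only [S, gpk_succ_zero] using shortfall_aggregate_le G q (S (l + l₀) R) p
    · obtain ⟨r, rfl⟩ := Nat.exists_eq_add_of_lt hR
      exact (shortfall_gpk_tanh_diag_le hc (l + l₀) _ u₀).trans
        (le_add_of_nonneg_right (mul_nonneg (Nat.cast_nonneg _) (hε₀ l)))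
  refine .of_comp_add (k := l₀) (.pi fun p => ?_)
  refine (((hshort.apply p).add (hε.const_mul r)).add hε).of_norm_le 1 fun l => ?_
  rw [one_mul]
  calc |S (l + l₀) r p.1 p.2 - q| ≤ shortfall q (S (l + l₀) r) p + ε l :=
        abs_sub_le_shortfall_add (hε₀ l) (hup _ r p.1 p.2)
    _ ≤ shortfall q (S (l + l₀) 0) p + r * ε l + ε l := add_le_add_left (hgrow l r p) _
    _ ≤ _ := Real.le_norm_self _

theorem exists_linear_growth_gntk_tanh [Nonempty V] (hc : TanhCritical q σw σb)
    (hirr : (aggMatrix G).IsIrreducible) :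
    ∃ c κ : ℝ, ∀ r ≤ R, ExpDecay fun l (p : V × V) =>
      gntk G h tanh σw σb R l r p.1 p.2 - (R * l * c + (κ + r * c)) := by
  refine ⟨q, exists_linear_growth_gntk hirr (fun r hr => ?_)
    fun r hr => expDecay_gpk_tanh hc (Nat.zero_lt_of_lt hr) hirr (r + 1)⟩
  have hS (l : ℕ) := posSemidef_gpk_tanh (G := G) (h := h) (σw := σw) (σb := σb) (R := R) l r
  have hlim := expDecay_gpk_tanh (h := h) hc (Nat.zero_lt_of_lt hr) hirr r
  have hnorm (l : ℕ) := norm_le_pi_norm fun p : V × V => gpk G h tanh σw σb R l r p.1 p.2 - q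
  refine hlim.of_norm_le (σw ^ 2 * (2 * 1 * 2 / √q + 2 * 2 ^ 2)) fun l =>
    (pi_norm_le_iff_of_nonneg (by positivity)).2 fun p => ?_
  have hslope : covDotStep tanh σw (gpk G h tanh σw σb R l r) p.1 p.2 - 1 =
      σw ^ 2 * (pairExp sechSq (gpk G h tanh σw σb R l r p.1 p.1)
        (gpk G h tanh σw σb R l r p.1 p.2) (gpk G h tanh σw σb R l r p.2 p.2) -
          pairExp sechSq q q q) := by
    rw [covDotStep_eq_pairExp _ _ (symm_of_posSemidef (hS l) p.1 p.2), deriv_tanh, mul_sub,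
      hc.slope_eq]
  rw [hslope, norm_mul, Real.norm_of_nonneg (sq_nonneg σw), mul_assoc]
  gcongr
  exact abs_pairExp_sub_pairExp_self_le continuous_sechSq.measurable abs_sechSq_le_one
    abs_sechSq_sub_le hc.pos (diag_nonneg_of_posSemidef (hS l) p.1)
    (diag_nonneg_of_posSemidef (hS l) p.2) (sq_le_mul_of_posSemidef (hS l) p.1 p.2)
    (hnorm l (p.1, p.1)) (hnorm l p) (hnorm l (p.2, p.2))

end TanhKernel

end GNTK

theorem theorem1 {V : Type*} [Fintype V] [DecidableEq V] (G : SimpleGraph V) [DecidableRel G.Adj]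
    {d : ℕ} (h : V → EuclideanSpace ℝ (Fin d)) (R : ℕ)
    (φ : ℝ → ℝ) (hφ : φ = GNTK.relu ∨ φ = Real.tanh)
    (σw σb : ℝ) (hcrit : GNTK.EdgeOfChaos φ σw σb)
    (hirr : (GNTK.aggMatrix G).IsIrreducible) (haper : GNTK.IsAperiodic (GNTK.aggMatrix G))
    (π : V × V → ℝ) (hπ : GNTK.IsStationaryDistribution (GNTK.aggMatrix G) π) :
    ∃ α C : ℝ, 0 < α ∧ α < 1 ∧ 0 < C ∧
      ∃ (v : V × V → ℝ) (v' : ℕ → V × V → ℝ),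
        (∀ r ≤ R, ∀ (l : ℕ) (u u' : V),
          |GNTK.gntk G h φ σw σb R l r u u' - π ⬝ᵥ (((R : ℝ) * (l : ℝ)) • v + v' r)| ≤ C * α ^ l) ∧
        (∀ r ≤ R, ∀ (l : ℕ) (u u' w w' : V),
          |GNTK.gntk G h φ σw σb R l r u u' - GNTK.gntk G h φ σw σb R l r w w'|
            ≤ 2 * C * α ^ l) := by
  have : Nonempty V := by
    by_contra hV
    rw [not_nonempty_iff] at hV
    simpa using hπ.2.1
  obtain ⟨c, κ, hgrow⟩ : ∃ c κ : ℝ, ∀ r ≤ R, GNTK.ExpDecay fun l (p : V × V) =>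
      GNTK.gntk G h φ σw σb R l r p.1 p.2 - (R * l * c + (κ + r * c)) := by
    rcases hφ with rfl | rfl
    · obtain ⟨hw, hb⟩ := GNTK.edgeOfChaos_relu hcrit
      exact GNTK.exists_linear_growth_gntk_relu hw hb hirr
    · obtain ⟨q, hq⟩ := GNTK.exists_tanhCritical_of_edgeOfChaos hcrit
      exact GNTK.exists_linear_growth_gntk_tanh hq hirr
  obtain ⟨α, ⟨hα0, hα1⟩, C, hC, hle⟩ := GNTK.ExpDecay.exists_forall_mem_norm_le (Finset.Iic R)
    fun r hr => hgrow r (Finset.mem_Iic.1 hr)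
  have hentry (r) (hr : r ≤ R) (l) (u u' : V) :
      |GNTK.gntk G h φ σw σb R l r u u' - (R * l * c + (κ + r * c))| ≤ C * α ^ l :=
    (norm_le_pi_norm (fun p : V × V => GNTK.gntk G h φ σw σb R l r p.1 p.2 -
      (R * l * c + (κ + r * c))) (u, u')).trans (hle r (Finset.mem_Iic.2 hr) l)
  refine ⟨α, C, hα0, hα1, hC, fun _ => c, fun r _ => κ + r * c, fun r hr l u u' => ?_,
    fun r hr l u u' w w' => ?_⟩
  · convert hentry r hr l u u'
    simp [dotProduct, ← Finset.sum_mul, hπ.2.1]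
  · linarith [abs_sub_le (GNTK.gntk G h φ σw σb R l r u u') (R * l * c + (κ + r * c))
      (GNTK.gntk G h φ σw σb R l r w w'), hentry r hr l u u',
      abs_sub_comm (R * l * c + (κ + r * c)) (GNTK.gntk G h φ σw σb R l r w w'),
      hentry r hr l w w']
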